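/- **Definitions.** A *restriction semigroup* is a semigroup $S$ with a unary operation $^*$ satisfying $xx^*=x$, $x^*y^*=y^*x^*=(x^*y^*)^*$, $(xy)^*=(x^*y)^*$ and $x^*y=y(xy)^*$. Its *projections* are the elements of $P(S)=\{s^*: s\in S\}$; the natural partial order is $s\le t\iff s=ts^*$, and under it $P(S)$ is a meet-semilattice with $e\wedge f=ef$. $S$ *has local units* if for every $s\in S$ there are $e,f\in P(S)$ with $es=s=sf$. A $(\cdot,{}^*)$-*morphism* is a map preserving the product and $^*$. Elements $s,t$ are *compatible* if $st^*=ts^*$. A restriction semigroup with a zero that is a projection is *Boolean* if (1) compatible elements have a join, (2) $P(S)$ is a generalized Boolean algebra (a relatively complemented distributive lattice with $0$), and (3) whenever $s\vee t$ exists, $(s\vee t)u=su\vee tu$. A map $\varphi:E\to F$ from a meet-semilattice to a generalized Boolean algebra is *non-degenerate* if the ideal of $F$ generated by $\varphi(E)$ is $F$. A *morphism of Boolean restriction semigroups* is a $(\cdot,{}^*)$-morphism $\psi:S\to T$ whose restriction $P(S)\to P(T)$ preserves $0,\wedge,\vee$ and is non-degenerate. Let $S$ be a restriction semigroup with local units.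 Let $\widehat{P(S)}$ be the set of non-zero semilattice morphisms $\varphi:P(S)\to\{0,1\}$ with the topology inherited from $\{0,1\}^{P(S)}$, and $D_e=\{\varphi:\varphi(e)=1\}$. For $s\in S$ and $\varphi\in D_{s^*}$ let $\beta_s(\varphi)\in\widehat{P(S)}$ be given by $\beta_s(\varphi)(e)=\varphi((es)^*)$. The *universal category* $\mathscr C(S)$ has as arrows the germs $[s,\varphi]$ with $\varphi\in D_{s^*}$, where $[s,\varphi]=[t,\psi]$ iff $\varphi=\psi$ and there is $u\le s,t$ with $\varphi\in D_{u^*}$; the domain of $[s,\varphi]$ is $[s^*,\varphi]$, its range is $[e,\beta_s(\varphi)]$ for any $e\in P(S)$ with $\beta_s(\varphi)(e)=1$, and $[s,\beta_t(\varphi)][t,\varphi]=[st,\varphi]$. Its topology has as a basis the sets $(s,U)=\{[s,\varphi]:\varphi\in U\}$, $U\subseteq D_{s^*}$ open. A *compact slice* is a compact open set of arrows on which the domain map is a homeomorphism onto an open subset of the space of units (identity arrows). The *universal Booleanization* $\mathsf B(S)$ is the set of compact slices of $\mathscr C(S)$ with $UV=\{xy: x\in U,\ y\in V,\ xy \text{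 defined}\}$ and $U^*=\{\text{domain of }x: x\in U\}$; it is a Boolean restriction semigroup with local units, and $\iota:S\to\mathsf B(S)$, $\iota(s)=(s,D_{s^*})$, is a $(\cdot,{}^*)$-morphism. **Theorem.** Let $S$ be a restriction semigroup with local units, $T$ a Boolean restriction semigroup with local units, and $\alpha:S\to T$ a $(\cdot,{}^*)$-morphism such that $\alpha|_{P(S)}:P(S)\to P(T)$ is non-degenerate. Then there is a morphism $\psi:\mathsf B(S)\to T$ of Boolean restriction semigroups such that $\alpha=\psi\circ\iota$. -/

import Mathlib

set_option linter.unusedSectionVars false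

namespace UnivBool

/-! ## Restriction semigroups -/

/-- A (right) restriction semigroup `(S; ·, *)`; the unary operation `s ↦ s*` is written `dom`. -/
class RestrictionSemigroup (S : Type*) extends Semigroup S where
  dom : S → S
  mul_dom : ∀ x : S, x * dom x = x
  dom_comm : ∀ x y : S, dom x * dom y = dom y * dom x
  dom_dom_mul : ∀ x y : S, dom (dom x * dom y) = dom x * dom y
  dom_mul : ∀ x y : S, dom (x * y) = dom (dom x * y)
  dom_mul_eq : ∀ x y : S, dom x * y = y * dom (x * y)

open RestrictionSemigroup

/-- The set of projections `P(S) = {s* : s ∈ S}`, as a type. -/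
abbrev Proj (S : Type*) [RestrictionSemigroup S] : Type _ :=
  ↥(Set.range (dom : S → S))

/-- A restriction semigroup has local units if every `s` satisfies `e s = s = s f` for some
projections `e`, `f`. -/
class HasLocalUnits (S : Type*) [RestrictionSemigroup S] : Prop where
  exists_units : ∀ s : S, ∃ e f : Proj S, (e : S) * s = s ∧ s * (f : S) = s

section Basic

variable {S : Type*} [RestrictionSemigroup S]

theorem dom_idem (x : S) : dom x * dom x = dom x := by
  have h := dom_mul x (dom x)
  rw [mul_dom, dom_dom_mul] at h
  exact h.symm

theorem dom_dom (x : S) : dom (dom x) = dom x := by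
  have h := dom_dom_mul x x
  rwa [dom_idem] at h

theorem dom_mul_proj (s t : S) : dom (s * dom t) = dom s * dom t := by
  rw [dom_mul, dom_dom_mul]

/-- The natural partial order: `s ≤ t` iff `s = t s*`. -/
instance instPartialOrder : PartialOrder S where
  le s t := s = t * dom s
  le_refl s := (mul_dom s).symm
  le_trans s t u hst htu := by
    change s = t * dom s at hst
    change t = u * dom t at htu
    have h : dom s = dom t * dom s := by
      conv_lhs => rw [hst]
      exact dom_mul_proj t s
    calc s = t * dom s := hst
      _ = u * dom t * dom s := by rw [← htu]
      _ = u * dom s := by rw [mul_assoc, ← h]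
  le_antisymm s t hst hts := by
    change s = t * dom s at hst
    change t = s * dom t at hts
    have h : dom s = dom t * dom s := by
      conv_lhs => rw [hst]
      exact dom_mul_proj t s
    have h' : dom t = dom s * dom t := by
      conv_lhs => rw [hts]
      exact dom_mul_proj s t
    have hd : dom s = dom t := by rw [h, dom_comm, ← h']
    rw [hst, hd, mul_dom]

theorem le_def {s t : S} : s ≤ t ↔ s = t * dom s := Iff.rfl

theorem mul_dom_le (s t : S) : s * dom t ≤ s := by
  rw [le_def, dom_mul_proj, ← mul_assoc, mul_dom]

theorem dom_eq_of_le {s t : S} (h : s ≤ t) : dom s = dom t * dom s := by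
  conv_lhs => rw [le_def.1 h]
  exact dom_mul_proj t s

theorem mul_le_mul_rs {s s' t t' : S} (hs : s ≤ s') (ht : t ≤ t') : s * t ≤ s' * t' := by
  have h : s * t = s' * t' * dom (dom (s * t') * dom t) := by
    rw [dom_dom_mul]
    conv_lhs => rw [le_def.1 hs, le_def.1 ht]
    calc s' * dom s * (t' * dom t) = s' * (dom s * t') * dom t := by simp only [mul_assoc]
      _ = s' * (t' * dom (s * t')) * dom t := by rw [dom_mul_eq]
      _ = _ := by simp only [mul_assoc]
  rw [h]
  exact mul_dom_le _ _

theorem proj_dom (e : Proj S) : dom (e : S) = e := by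
  obtain ⟨_, s, rfl⟩ := e
  exact dom_dom s

/-- The projection `s*`, as an element of `P(S)`. -/
def pr (s : S) : Proj S := ⟨dom s, s, rfl⟩

/-- The projections form a meet-semilattice, with meet the product. -/
instance : SemilatticeInf (Proj S) where
  inf e f := ⟨(e : S) * f, (e : S) * f, by
    rw [← proj_dom e, ← proj_dom f, dom_dom_mul]⟩
  inf_le_left e f := by
    change (e : S) * f ≤ e
    rw [← proj_dom f]
    exact mul_dom_le _ _
  inf_le_right e f := by
    change (e : S) * f ≤ f
    rw [← proj_dom e, ← proj_dom f, dom_comm]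
    exact mul_dom_le _ _
  le_inf a b c hab hac := by
    have hab' : (a : S) = b * dom (a : S) := hab
    have hac' : (a : S) = c * dom (a : S) := hac
    change (a : S) = b * c * dom (a : S)
    rw [mul_assoc, ← hac']
    rw [proj_dom] at hab'
    exact hab'

theorem coe_inf (e f : Proj S) : ((e ⊓ f : Proj S) : S) = e * f := rfl

theorem pr_dom (s : S) : pr (dom s) = pr s := Subtype.ext (dom_dom s)

theorem pr_coe (e : Proj S) : pr (e : S) = e := Subtype.ext (proj_dom e)

theorem pr_mul_dom (s t : S) : pr (s * dom t) = pr s ⊓ pr t := Subtype.ext (dom_mul_proj s t)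

theorem pr_le {s t : S} (h : s ≤ t) : pr s ≤ pr t := by
  have h2 : dom s = dom t * dom s := dom_eq_of_le h
  change dom s = dom t * dom (dom s)
  rw [dom_dom]
  exact h2

theorem pr_inf_mul (e f : Proj S) (s : S) :
    pr (((e ⊓ f : Proj S) : S) * s) = pr ((e : S) * s) ⊓ pr ((f : S) * s) := by
  have h : (f : S) * s = s * dom ((f : S) * s) := by
    conv_lhs => rw [← proj_dom f]
    exact dom_mul_eq _ _
  rw [← pr_mul_dom, mul_assoc, ← h, ← mul_assoc, coe_inf]

theorem pr_mul_le (s t : S) : pr (s * t) ≤ pr t := by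
  rw [← pr_dom t]
  have : s * t = s * t * dom t := by rw [mul_assoc, mul_dom]
  rw [this, pr_mul_dom, pr_dom]
  exact inf_le_right

end Basic

/-- A `(·, *)`-morphism of restriction semigroups. -/
structure RestrictionHom (S T : Type*) [RestrictionSemigroup S] [RestrictionSemigroup T] where
  toFun : S → T
  map_mul : ∀ x y : S, toFun (x * y) = toFun x * toFun y
  map_dom : ∀ x : S, toFun (dom x) = dom (toFun x)

/-- The restriction `P(S) → P(T)` of a `(·, *)`-morphism `S → T` to projections. -/
def RestrictionHom.onProj {S T : Type*} [RestrictionSemigroup S] [RestrictionSemigroup T]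
    (f : RestrictionHom S T) (e : Proj S) : Proj T :=
  ⟨f.toFun e, f.toFun e, by rw [← f.map_dom, proj_dom]⟩

/-! ## Boolean restriction semigroups -/

/-- The poset `E` is a generalized Boolean algebra. -/
def IsGenBoolAlg (E : Type*) [PartialOrder E] : Prop :=
  ∃ B : GeneralizedBooleanAlgebra E, ∀ x y : E, B.le x y ↔ x ≤ y

/-- A map `φ : E → F` is non-degenerate if the order ideal of `F` generated by its image is `F`. -/
def IsNonDegenerate {E F : Type*} [PartialOrder F] (φ : E → F) : Prop :=
  ∀ I : Order.Ideal F, Set.range φ ⊆ (I : Set F) → (I : Set F) = Set.univ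

/-- A (non-degenerate) morphism of generalized Boolean algebras. In such algebras the least
element, binary meets and binary joins exist, and `φ` is required to preserve them. -/
structure IsGenBoolMorphism {E F : Type*} [PartialOrder E] [PartialOrder F] (φ : E → F) :
    Prop where
  map_bot : ∀ z : E, IsBot z → IsBot (φ z)
  map_inf : ∀ x y m : E, IsGLB {x, y} m → IsGLB {φ x, φ y} (φ m)
  map_sup : ∀ x y j : E, IsLUB {x, y} j → IsLUB {φ x, φ y} (φ j)
  nonDegenerate : IsNonDegenerate φ

/-- Compatibility: `s t* = t s*`. -/
def Compatible {S : Type*} [RestrictionSemigroup S] (s t : S) : Prop :=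
  s * dom t = t * dom s

/-- Boolean restriction semigroups. Joins are taken in the natural partial order. -/
class BooleanRestrictionSemigroup (S : Type*) [RestrictionSemigroup S] : Prop where
  exists_zero : ∃ z : S, dom z = z ∧ ∀ s : S, z * s = z ∧ s * z = z
  exists_join : ∀ s t : S, Compatible s t → ∃ j : S, IsLUB {s, t} j
  proj_genBoolAlg : IsGenBoolAlg (Proj S)
  join_mul : ∀ s t u j : S, IsLUB {s, t} j → IsLUB {s * u, t * u} (j * u)

/-- A morphism of Boolean restriction semigroups. -/
structure BooleanRestrictionHom (S T : Type*) [RestrictionSemigroup S]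
    [BooleanRestrictionSemigroup S] [RestrictionSemigroup T] [BooleanRestrictionSemigroup T]
    extends RestrictionHom S T where
  onProj_morphism : IsGenBoolMorphism toRestrictionHom.onProj

/-! ## Topological, étale and ample categories; compact slices -/

/-- A small category, given by its set of arrows; objects are identified with identity arrows. -/
class ArrowCat (C : Type*) where
  src : C → C
  tgt : C → C
  /-- The product `x y`, defined when the domain of `x` is the range of `y`. -/
  comp : (x y : C) → src x = tgt y → C
  src_src : ∀ x, src (src x) = src x
  tgt_src : ∀ x, tgt (src x) = src x
  src_tgt : ∀ x, src (tgt x) = tgt x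
  tgt_tgt : ∀ x, tgt (tgt x) = tgt x
  src_comp : ∀ x y h, src (comp x y h) = src y
  tgt_comp : ∀ x y h, tgt (comp x y h) = tgt x
  comp_assoc : ∀ x y z (h : src x = tgt y) (k : src y = tgt z),
    comp (comp x y h) z ((src_comp x y h).trans k) =
      comp x (comp y z k) (h.trans (tgt_comp y z k).symm)
  tgt_comp_self : ∀ x, comp (tgt x) x (src_tgt x) = x
  comp_src_self : ∀ x, comp x (src x) (tgt_src x).symm = x

open ArrowCat

/-- The set of units `C⁽⁰⁾`. -/
def units (C : Type*) [ArrowCat C] : Set C := Set.range (src : C → C)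

/-- The domain map `C → C⁽⁰⁾`. -/
def srcU {C : Type*} [ArrowCat C] (x : C) : units C := ⟨src x, x, rfl⟩

/-- A topological category. -/
class IsTopologicalCat (C : Type*) [ArrowCat C] [TopologicalSpace C] : Prop where
  continuous_src : Continuous (src : C → C)
  continuous_tgt : Continuous (tgt : C → C)
  continuous_comp :
    Continuous fun p : {p : C × C // src p.1 = tgt p.2} => comp p.1.1 p.1.2 p.2

/-- A slice: an open set on which the domain map is a homeomorphism onto an open subset of the
space of units. -/
structure IsSlice {C : Type*} [ArrowCat C] [TopologicalSpace C] (U : Set C) : Prop where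
  isOpen : IsOpen U
  isOpenEmbedding : Topology.IsOpenEmbedding (U.domRestrict (srcU : C → units C))

/-- An étale category. -/
class IsEtale (C : Type*) [ArrowCat C] [TopologicalSpace C] : Prop extends
    IsTopologicalCat C where
  locallyCompact : LocallyCompactSpace (units C)
  hausdorff : T2Space (units C)
  localHomeo : IsLocalHomeomorph (srcU : C → units C)

/-- An ample category. -/
class IsAmple (C : Type*) [ArrowCat C] [TopologicalSpace C] : Prop extends IsEtale C where
  isBasis : TopologicalSpace.IsTopologicalBasis {U : Set C | IsSlice U ∧ IsCompact U}

/-- The product of two sets of arrows. -/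
def setMul {C : Type*} [ArrowCat C] (U V : Set C) : Set C :=
  {z | ∃ x ∈ U, ∃ y ∈ V, ∃ h : src x = tgt y, comp x y h = z}

/-- The set of compact slices, denoted `Cᵃ`. -/
def CompactSlice (C : Type*) [ArrowCat C] [TopologicalSpace C] : Type _ :=
  {U : Set C // IsSlice U ∧ IsCompact U}

section Slices

variable {C : Type*} [ArrowCat C]

theorem comp_congr {x x' y y' : C} (hx : x = x') (hy : y = y') (h : src x = tgt y)
    (h' : src x' = tgt y') : comp x y h = comp x' y' h' := by
  subst hx hy
  rfl

theorem mem_units_iff {x : C} : x ∈ units C ↔ src x = x := by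
  constructor
  · rintro ⟨y, rfl⟩
    exact src_src y
  · intro h
    exact ⟨x, h⟩

theorem tgt_mem_units (x : C) : tgt x ∈ units C := ⟨tgt x, src_tgt x⟩

theorem tgt_of_unit {x : C} (h : src x = x) : tgt x = x := by
  rw [← h, tgt_src]

theorem comp_unit_right {x y : C} (h : src x = tgt y) (hy : src y = y) : comp x y h = x := by
  have h1 : y = src x := by rw [h, tgt_of_unit hy]
  rw [comp_congr rfl h1 h (tgt_src x).symm, comp_src_self]

theorem comp_unit_left {x y : C} (h : src x = tgt y) (hx : src x = x) : comp x y h = y := by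
  have h1 : x = tgt y := by rw [← h, hx]
  rw [comp_congr h1 rfl h (src_tgt y), tgt_comp_self]

theorem setMul_assoc (U V W : Set C) : setMul (setMul U V) W = setMul U (setMul V W) := by
  ext z
  constructor
  · rintro ⟨_, ⟨x, hx, y, hy, h, rfl⟩, w, hw, k, rfl⟩
    have k' : src y = tgt w := (src_comp x y h).symm.trans k
    exact ⟨x, hx, comp y w k', ⟨y, hy, w, hw, k', rfl⟩, h.trans (tgt_comp y w k').symm,
      (comp_assoc x y w h k').symm⟩
  · rintro ⟨x, hx, _, ⟨y, hy, w, hw, k, rfl⟩, h, rfl⟩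
    have h' : src x = tgt y := h.trans (tgt_comp y w k)
    exact ⟨comp x y h', ⟨x, hx, y, hy, h', rfl⟩, w, hw, (src_comp x y h').trans k,
      comp_assoc x y w h' k⟩

theorem mem_setMul_src {U V : Set C} {x : C} :
    x ∈ setMul U (src '' V) ↔ x ∈ U ∧ src x ∈ src '' V := by
  constructor
  · rintro ⟨u, hu, _, ⟨v, hv, rfl⟩, h, rfl⟩
    rw [comp_unit_right h (src_src v)]
    exact ⟨hu, v, hv, by rw [h, tgt_src]⟩
  · rintro ⟨hx, hs⟩
    exact ⟨x, hx, src x, hs, (tgt_src x).symm, comp_src_self x⟩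

theorem mem_src_setMul {U V : Set C} {x : C} :
    x ∈ setMul (src '' U) V ↔ x ∈ V ∧ tgt x ∈ src '' U := by
  constructor
  · rintro ⟨_, ⟨u, hu, rfl⟩, v, hv, h, rfl⟩
    rw [comp_unit_left h (src_src u)]
    exact ⟨hv, u, hu, by rw [← h, src_src]⟩
  · rintro ⟨hx, hs⟩
    exact ⟨tgt x, hs, x, hx, src_tgt x, tgt_comp_self x⟩

theorem src_setMul (U V : Set C) : src '' setMul U V = src '' setMul (src '' U) V := by
  ext z
  constructor
  · rintro ⟨_, ⟨x, hx, y, hy, h, rfl⟩, rfl⟩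
    exact ⟨y, mem_src_setMul.2 ⟨hy, x, hx, h⟩, (src_comp x y h).symm⟩
  · rintro ⟨y, hy, rfl⟩
    obtain ⟨hy, x, hx, h⟩ := mem_src_setMul.1 hy
    exact ⟨comp x y h, ⟨x, hx, y, hy, h, rfl⟩, src_comp x y h⟩

variable [TopologicalSpace C]

theorem IsSlice.injOn {U : Set C} (h : IsSlice U) : Set.InjOn src U := by
  intro x hx y hy hxy
  have := h.isOpenEmbedding.injective (a₁ := ⟨x, hx⟩) (a₂ := ⟨y, hy⟩) (Subtype.ext hxy)
  exact congrArg Subtype.val this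

theorem setMul_src_self {U : Set C} : setMul U (src '' U) = U := by
  ext x
  rw [mem_setMul_src]
  exact ⟨fun h => h.1, fun h => ⟨h, x, h, rfl⟩⟩

variable [IsEtale C]

theorem isSlice_iff {U : Set C} : IsSlice U ↔ IsOpen U ∧ Set.InjOn src U := by
  refine ⟨fun h => ⟨h.isOpen, h.injOn⟩, fun ⟨ho, hi⟩ => ⟨ho, ?_⟩⟩
  have hl : IsLocalHomeomorph (srcU : C → units C) := IsEtale.localHomeo
  refine Topology.IsOpenEmbedding.of_continuous_injective_isOpenMap
    (hl.continuous.comp continuous_subtype_val) ?_ (hl.isOpenMap.comp ho.isOpenMap_subtype_val)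
  rintro ⟨x, hx⟩ ⟨y, hy⟩ hxy
  exact Subtype.ext (hi hx hy (congrArg Subtype.val hxy))

theorem exists_slice (x : C) : ∃ U : Set C, IsOpen U ∧ x ∈ U ∧ Set.InjOn src U := by
  have hl : IsLocalHomeomorph (srcU : C → units C) := IsEtale.localHomeo
  obtain ⟨e, hx, he⟩ := hl x
  refine ⟨e.source, e.open_source, hx, fun y hy z hz hyz => e.injOn hy hz ?_⟩
  rw [← he]
  exact Subtype.ext hyz

theorem isOpen_units : IsOpen (units C) := by
  rw [isOpen_iff_forall_mem_open]
  intro x hx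
  have hs := mem_units_iff.1 hx
  obtain ⟨U, hU, hxU, hi⟩ := exists_slice x
  refine ⟨U ∩ src ⁻¹' U, ?_, hU.inter (hU.preimage IsTopologicalCat.continuous_src), hxU, ?_⟩
  · rintro y ⟨hy, hy'⟩
    exact mem_units_iff.2 (hi hy' hy (src_src y))
  · change src x ∈ U
    rwa [hs]

theorem isOpen_src_image {U : Set C} (hU : IsOpen U) : IsOpen (src '' U) := by
  have hl : IsLocalHomeomorph (srcU : C → units C) := IsEtale.localHomeo
  have h := isOpen_units.isOpenMap_subtype_val _ (hl.isOpenMap U hU)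
  rw [Set.image_image] at h
  exact h

theorem injOn_setMul {U V : Set C} (hU : Set.InjOn src U) (hV : Set.InjOn src V) :
    Set.InjOn src (setMul U V) := by
  rintro _ ⟨x, hx, y, hy, h, rfl⟩ _ ⟨x', hx', y', hy', h', rfl⟩ he
  rw [src_comp, src_comp] at he
  have h1 := hV hy hy' he
  have h2 : x = x' := hU hx hx' (by rw [h, h', h1])
  exact comp_congr h2 h1 h h'

theorem isOpen_setMul {U V : Set C} (hU : IsOpen U) (hV : IsOpen V) : IsOpen (setMul U V) := by
  rw [isOpen_iff_forall_mem_open]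
  rintro _ ⟨x, hx, y, hy, h, rfl⟩
  obtain ⟨O, hO, hzO, hi⟩ := exists_slice (comp x y h)
  have hc := (IsTopologicalCat.continuous_comp (C := C)).isOpen_preimage O hO
  obtain ⟨Q, hQ, hQe⟩ := isOpen_induced_iff.1 hc
  have hxy : (x, y) ∈ Q := by
    have : (⟨(x, y), h⟩ : {p : C × C // src p.1 = tgt p.2}) ∈ Subtype.val ⁻¹' Q := by
      rw [hQe]
      exact hzO
    exact this
  obtain ⟨A, B, hA, hB, hxA, hyB, hAB⟩ := isOpen_prod_iff.1 hQ x y hxy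
  have hAU : IsOpen (src '' (A ∩ U)) := isOpen_src_image (hA.inter hU)
  have hB' : IsOpen ((B ∩ V) ∩ tgt ⁻¹' (src '' (A ∩ U))) :=
    (hB.inter hV).inter (hAU.preimage IsTopologicalCat.continuous_tgt)
  refine ⟨O ∩ src ⁻¹' (src '' ((B ∩ V) ∩ tgt ⁻¹' (src '' (A ∩ U)))), ?_,
    hO.inter ((isOpen_src_image hB').preimage IsTopologicalCat.continuous_src), hzO,
    ⟨y, ⟨⟨hyB, hy⟩, x, ⟨hxA, hx⟩, h⟩, (src_comp x y h).symm⟩⟩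
  rintro w ⟨hwO, b, ⟨⟨hbB, hbV⟩, a, ⟨haA, haU⟩, hab⟩, hbw⟩
  have hO' : comp a b hab ∈ O := by
    have : (⟨(a, b), hab⟩ : {p : C × C // src p.1 = tgt p.2}) ∈ Subtype.val ⁻¹' Q :=
      hAB ⟨haA, hbB⟩
    rw [hQe] at this
    exact this
  exact ⟨a, haU, b, hbV, hab, hi hO' hwO (by rw [src_comp, hbw])⟩

theorem isCompact_setMul {U V : Set C} (hU : IsCompact U) (hV : IsCompact V) :
    IsCompact (setMul U V) := by
  have : T2Space (units C) := IsEtale.hausdorff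
  have hs : Continuous (srcU : C → units C) :=
    (IsTopologicalCat.continuous_src (C := C)).subtype_mk _
  have ht : Continuous (fun x : C => (⟨tgt x, tgt_mem_units x⟩ : units C)) :=
    (IsTopologicalCat.continuous_tgt (C := C)).subtype_mk _
  have hcl : IsClosed {p : C × C | src p.1 = tgt p.2} := by
    have := isClosed_eq (hs.comp continuous_fst) (ht.comp (continuous_snd (X := C)))
    convert this using 1
    ext p
    exact (Subtype.ext_iff (a1 := srcU p.1) (a2 := ⟨tgt p.2, tgt_mem_units p.2⟩)).symm
  have hK := (hcl.isClosedEmbedding_subtypeVal).isCompact_preimage (hU.prod hV)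
  have hI := hK.image (IsTopologicalCat.continuous_comp (C := C))
  convert hI using 1
  ext z
  constructor
  · rintro ⟨x, hx, y, hy, h, rfl⟩
    exact ⟨⟨(x, y), h⟩, ⟨hx, hy⟩, rfl⟩
  · rintro ⟨⟨⟨x, y⟩, h⟩, ⟨hx, hy⟩, rfl⟩
    exact ⟨x, hx, y, hy, h, rfl⟩

theorem injOn_of_subset_units {U : Set C} (h : U ⊆ units C) : Set.InjOn src U := by
  intro x hx y hy hxy
  rwa [mem_units_iff.1 (h hx), mem_units_iff.1 (h hy)] at hxy

theorem isOpen_units_diff {L : Set C} (hL : IsCompact L) (hLu : L ⊆ units C) :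
    IsOpen (units C \ L) := by
  have : T2Space (units C) := IsEtale.hausdorff
  have hL' : IsCompact (Subtype.val ⁻¹' L : Set (units C)) := by
    rw [Subtype.isCompact_iff, Subtype.image_preimage_coe, Set.inter_eq_self_of_subset_right hLu]
    exact hL
  have h := isOpen_units.isOpenMap_subtype_val _ hL'.isClosed.isOpen_compl
  convert h using 1
  ext x
  simp

/-- The restriction semigroup of compact slices of an étale category: the product is the product
of sets of arrows, and `U* = {domain of x : x ∈ U}`. -/
instance : RestrictionSemigroup (CompactSlice C) where
  mul U V := ⟨setMul U.1 V.1,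
    isSlice_iff.2 ⟨isOpen_setMul U.2.1.isOpen V.2.1.isOpen,
      injOn_setMul U.2.1.injOn V.2.1.injOn⟩, isCompact_setMul U.2.2 V.2.2⟩
  mul_assoc U V W := Subtype.ext (setMul_assoc U.1 V.1 W.1)
  dom U := ⟨src '' U.1,
    isSlice_iff.2 ⟨isOpen_src_image U.2.1.isOpen,
      injOn_of_subset_units (Set.image_subset_range _ _)⟩,
    U.2.2.image IsTopologicalCat.continuous_src⟩
  mul_dom U := Subtype.ext setMul_src_self
  dom_comm U V := by
    apply Subtype.ext
    change setMul (src '' U.1) (src '' V.1) = setMul (src '' V.1) (src '' U.1)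
    ext x
    rw [mem_setMul_src, mem_setMul_src]
    constructor
    · rintro ⟨⟨u, hu, rfl⟩, h⟩
      rw [src_src] at *
      exact ⟨h, u, hu, rfl⟩
    · rintro ⟨⟨u, hu, rfl⟩, h⟩
      rw [src_src] at *
      exact ⟨h, u, hu, rfl⟩
  dom_dom_mul U V := by
    apply Subtype.ext
    change src '' setMul (src '' U.1) (src '' V.1) = setMul (src '' U.1) (src '' V.1)
    ext x
    constructor
    · rintro ⟨y, hy, rfl⟩
      obtain ⟨⟨u, hu, rfl⟩, h⟩ := mem_setMul_src.1 hy
      rwa [src_src]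
    · intro hx
      refine ⟨x, hx, ?_⟩
      obtain ⟨⟨u, hu, rfl⟩, h⟩ := mem_setMul_src.1 hx
      exact src_src u
  dom_mul U V := Subtype.ext (src_setMul U.1 V.1)
  dom_mul_eq U V := by
    apply Subtype.ext
    change setMul (src '' U.1) V.1 = setMul V.1 (src '' setMul U.1 V.1)
    ext x
    rw [mem_src_setMul, mem_setMul_src]
    constructor
    · rintro ⟨hx, u, hu, h⟩
      exact ⟨hx, comp u x h, ⟨u, hu, x, hx, h, rfl⟩, src_comp u x h⟩
    · rintro ⟨hx, _, ⟨u, hu, v, hv, h, rfl⟩, hs⟩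
      rw [src_comp] at hs
      obtain rfl := V.2.1.injOn hv hx hs
      exact ⟨hx, u, hu, h⟩

theorem coe_mul_slice (U V : CompactSlice C) : (U * V).1 = setMul U.1 V.1 := rfl

theorem coe_dom_slice (U : CompactSlice C) : (dom U).1 = src '' U.1 := rfl

theorem slice_le_iff {U V : CompactSlice C} : U ≤ V ↔ U.1 ⊆ V.1 := by
  rw [le_def]
  constructor
  · intro h x hx
    rw [h, coe_mul_slice, coe_dom_slice, mem_setMul_src] at hx
    exact hx.1
  · intro h
    apply Subtype.ext
    rw [coe_mul_slice, coe_dom_slice]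
    ext x
    rw [mem_setMul_src]
    constructor
    · intro hx
      exact ⟨h hx, x, hx, rfl⟩
    · rintro ⟨hx, u, hu, hs⟩
      obtain rfl := V.2.1.injOn (h hu) hx hs
      exact hu

theorem isLUB_union {U V W : CompactSlice C} (h : W.1 = U.1 ∪ V.1) : IsLUB {U, V} W := by
  constructor
  · rintro x (rfl | rfl)
    · rw [slice_le_iff, h]
      exact Set.subset_union_left
    · rw [slice_le_iff, h]
      exact Set.subset_union_right
  · intro X hX
    rw [slice_le_iff, h]
    exact Set.union_subset (slice_le_iff.1 (hX (Set.mem_insert _ _)))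
      (slice_le_iff.1 (hX (Set.mem_insert_of_mem _ rfl)))

theorem eq_union_of_isLUB {U V W : CompactSlice C} (h : IsLUB {U, V} W) : W.1 = U.1 ∪ V.1 := by
  have hU : U.1 ⊆ W.1 := slice_le_iff.1 (h.1 (Set.mem_insert _ _))
  have hV : V.1 ⊆ W.1 := slice_le_iff.1 (h.1 (Set.mem_insert_of_mem _ rfl))
  let X : CompactSlice C := ⟨U.1 ∪ V.1,
    isSlice_iff.2 ⟨U.2.1.isOpen.union V.2.1.isOpen, W.2.1.injOn.mono (Set.union_subset hU hV)⟩,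
    U.2.2.union V.2.2⟩
  have hX : IsLUB {U, V} X := isLUB_union rfl
  rw [h.unique hX]

theorem proj_subset_units (e : Proj (CompactSlice C)) : e.1.1 ⊆ units C := by
  obtain ⟨_, U, rfl⟩ := e
  exact Set.image_subset_range _ _

/-- A compact open set of units, as a projection. -/
def mkProj (K : Set C) (ho : IsOpen K) (hc : IsCompact K) (hu : K ⊆ units C) :
    Proj (CompactSlice C) :=
  ⟨⟨K, isSlice_iff.2 ⟨ho, injOn_of_subset_units hu⟩, hc⟩,
    ⟨K, isSlice_iff.2 ⟨ho, injOn_of_subset_units hu⟩, hc⟩, by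
      apply Subtype.ext
      change src '' K = K
      ext x
      constructor
      · rintro ⟨y, hy, rfl⟩
        rwa [mem_units_iff.1 (hu hy)]
      · intro hx
        exact ⟨x, hx, mem_units_iff.1 (hu hx)⟩⟩

theorem isOpen_diff {K L : Set C} (ho : IsOpen K) (hu : K ⊆ units C) (hL : IsCompact L)
    (hLu : L ⊆ units C) : IsOpen (K \ L) := by
  have : K \ L = K ∩ (units C \ L) := by
    ext x
    exact ⟨fun h => ⟨h.1, hu h.1, h.2⟩, fun h => ⟨h.1, h.2.2⟩⟩
  rw [this]
  exact ho.inter (isOpen_units_diff hL hLu)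

theorem genBoolAlg_proj_slice : IsGenBoolAlg (Proj (CompactSlice C)) := by
  let i : Proj (CompactSlice C) → Set C := fun e => e.1.1
  have hi : Function.Injective i := fun e f h => Subtype.ext (Subtype.ext h)
  have ho : ∀ e, IsOpen (i e) := fun e => e.1.2.1.isOpen
  have hc : ∀ e, IsCompact (i e) := fun e => e.1.2.2
  have hu : ∀ e, i e ⊆ units C := proj_subset_units
  let sup' : Max (Proj (CompactSlice C)) := ⟨fun e f => mkProj (i e ∪ i f)
    ((ho e).union (ho f)) ((hc e).union (hc f)) (Set.union_subset (hu e) (hu f))⟩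
  have hd : ∀ e f, IsOpen (i e \ i f) := fun e f => isOpen_diff (ho e) (hu e) (hc f) (hu f)
  let inf' : Min (Proj (CompactSlice C)) := ⟨fun e f => mkProj (i e ∩ i f)
    ((ho e).inter (ho f)) (by
      rw [← Set.sdiff_sdiff_right_self]
      exact (hc e).diff (hd e f)) (Set.inter_subset_left.trans (hu e))⟩
  let bot' : Bot (Proj (CompactSlice C)) :=
    ⟨mkProj ∅ isOpen_empty isCompact_empty (Set.empty_subset _)⟩
  let sd' : SDiff (Proj (CompactSlice C)) := ⟨fun e f => mkProj (i e \ i f)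
    (hd e f) ((hc e).diff (ho f)) (Set.sdiff_subset.trans (hu e))⟩
  refine ⟨Function.Injective.generalizedBooleanAlgebra i hi
    (fun {x y} => (slice_le_iff (U := x.1) (V := y.1)).symm)
    (fun {x y} => ?_) (fun _ _ => rfl) (fun _ _ => rfl) rfl (fun _ _ => rfl), fun x y => Iff.rfl⟩
  rw [lt_iff_le_not_ge, lt_iff_le_not_ge]
  exact and_congr (slice_le_iff (U := x.1) (V := y.1)).symm
    (not_congr (slice_le_iff (U := y.1) (V := x.1)).symm)

instance : BooleanRestrictionSemigroup (CompactSlice C) where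
  exists_zero := by
    refine ⟨⟨∅, isSlice_iff.2 ⟨isOpen_empty, Set.injOn_empty _⟩, isCompact_empty⟩,
      Subtype.ext (Set.image_empty _), fun s => ⟨?_, ?_⟩⟩
    · apply Subtype.ext
      ext x
      exact ⟨fun ⟨_, h, _⟩ => h, fun h => h.elim⟩
    · apply Subtype.ext
      ext x
      exact ⟨fun ⟨_, _, _, h, _⟩ => h, fun h => h.elim⟩
  exists_join := by
    intro s t hst
    have key : ∀ x ∈ s.1, ∀ y ∈ t.1, src x = src y → x = y := by
      intro x hx y hy hxy
      have h1 : x ∈ (s * dom t).1 := mem_setMul_src.2 ⟨hx, y, hy, hxy.symm⟩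
      rw [show s * dom t = t * dom s from hst] at h1
      exact t.2.1.injOn (mem_setMul_src.1 h1).1 hy hxy
    refine ⟨⟨s.1 ∪ t.1, isSlice_iff.2 ⟨s.2.1.isOpen.union t.2.1.isOpen, ?_⟩,
      s.2.2.union t.2.2⟩, isLUB_union rfl⟩
    rintro x (hx | hx) y (hy | hy) hxy
    · exact s.2.1.injOn hx hy hxy
    · exact key x hx y hy hxy
    · exact (key y hy x hx hxy.symm).symm
    · exact t.2.1.injOn hx hy hxy
  proj_genBoolAlg := genBoolAlg_proj_slice
  join_mul := by
    intro s t u j hj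
    apply isLUB_union
    change setMul j.1 u.1 = setMul s.1 u.1 ∪ setMul t.1 u.1
    rw [eq_union_of_isLUB hj]
    ext z
    constructor
    · rintro ⟨x, hx | hx, hz⟩
      · exact Or.inl ⟨x, hx, hz⟩
      · exact Or.inr ⟨x, hx, hz⟩
    · rintro (⟨x, hx, hz⟩ | ⟨x, hx, hz⟩)
      · exact ⟨x, Or.inl hx, hz⟩
      · exact ⟨x, Or.inr hx, hz⟩

end Slices

instance {C : Type*} [ArrowCat C] [TopologicalSpace C] [IsAmple C] :
    HasLocalUnits (CompactSlice C) where
  exists_units := by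
    intro s
    suffices h : ∃ K : Set C, IsOpen K ∧ IsCompact K ∧ K ⊆ units C ∧ tgt '' s.1 ⊆ K by
      obtain ⟨K, ho, hc, hu, hK⟩ := h
      refine ⟨mkProj K ho hc hu, pr s, ?_, mul_dom s⟩
      apply Subtype.ext
      change setMul K s.1 = s.1
      ext x
      constructor
      · rintro ⟨k, hk, y, hy, h, rfl⟩
        rwa [comp_unit_left h (mem_units_iff.1 (hu hk))]
      · intro hx
        exact ⟨tgt x, hK ⟨x, hx, rfl⟩, x, hx, src_tgt x, tgt_comp_self x⟩
    have hc : IsCompact (tgt '' s.1) := s.2.2.image IsTopologicalCat.continuous_tgt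
    refine hc.induction_on (p := fun A => ∃ K : Set C, IsOpen K ∧ IsCompact K ∧ K ⊆ units C ∧
      A ⊆ K) ?_ ?_ ?_ ?_
    · exact ⟨∅, isOpen_empty, isCompact_empty, Set.empty_subset _, Set.empty_subset _⟩
    · rintro A B hAB ⟨K, h1, h2, h3, h4⟩
      exact ⟨K, h1, h2, h3, hAB.trans h4⟩
    · rintro A B ⟨K, h1, h2, h3, h4⟩ ⟨L, k1, k2, k3, k4⟩
      exact ⟨K ∪ L, h1.union k1, h2.union k2, Set.union_subset h3 k3,
        Set.union_subset_union h4 k4⟩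
    · rintro _ ⟨x, hx, rfl⟩
      obtain ⟨K, ⟨hK, hKc⟩, hxK, hKu⟩ := (IsAmple.isBasis (C := C)).exists_subset_of_mem_open
        (tgt_mem_units x) isOpen_units
      exact ⟨K, mem_nhdsWithin_of_mem_nhds (hK.isOpen.mem_nhds hxK), K, hK.isOpen, hKc, hKu,
        subset_rfl⟩

/-! ## The spectrum of a semilattice and the spectral action -/

/-- The character space of a meet-semilattice: non-zero semilattice morphisms to `{0, 1}`, with the
topology inherited from the product `{0, 1}^E`. -/
abbrev Spectrum (E : Type*) [SemilatticeInf E] : Type _ :=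
  {φ : E → Bool // (∃ e, φ e = true) ∧ ∀ e f, φ (e ⊓ f) = (φ e && φ f)}

section Spectrum

variable {E : Type*} [SemilatticeInf E]

/-- The basic set of characters `φ` with `φ e = 1`. -/
def Dset (e : E) : Set (Spectrum E) := {φ | φ.1 e = true}

theorem Dset_inf (e f : E) : Dset (e ⊓ f) = Dset e ∩ Dset f := by
  ext φ
  change φ.1 (e ⊓ f) = true ↔ φ.1 e = true ∧ φ.1 f = true
  rw [φ.2.2, Bool.and_eq_true]

theorem Dset_mono {e f : E} (h : e ≤ f) : Dset e ⊆ Dset f := by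
  have := Dset_inf e f
  rw [inf_eq_left.2 h] at this
  rw [this]
  exact Set.inter_subset_right

theorem continuous_eval (e : E) : Continuous fun φ : Spectrum E => φ.1 e :=
  (continuous_apply e).comp continuous_subtype_val

theorem isOpen_Dset (e : E) : IsOpen (Dset e) :=
  (isOpen_discrete {true}).preimage (continuous_eval e)

theorem isCompact_Dset_inter (e : E) {K : Set (E → Bool)} (hK : IsClosed K) :
    IsCompact (Dset e ∩ Subtype.val ⁻¹' K : Set (Spectrum E)) := by
  rw [Subtype.isCompact_iff]
  have hcl : IsClosed ({φ : E → Bool | φ e = true} ∩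
      {φ : E → Bool | ∀ a b, φ (a ⊓ b) = (φ a && φ b)} ∩ K) := by
    refine (IsClosed.inter ?_ ?_).inter hK
    · exact isClosed_eq (continuous_apply e) continuous_const
    · simp only [Set.ofPred_forall]
      refine isClosed_iInter fun a => isClosed_iInter fun b => isClosed_eq (continuous_apply _) ?_
      have hc : Continuous fun p : Bool × Bool => (p.1 && p.2) := continuous_of_discreteTopology
      exact hc.comp (f := fun φ : E → Bool => (φ a, φ b))
        ((continuous_apply a).prodMk (continuous_apply b))
  convert hcl.isCompact using 1
  ext φ
  constructor
  · rintro ⟨ψ, ⟨h1, h2⟩, rfl⟩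
    exact ⟨⟨h1, ψ.2.2⟩, h2⟩
  · rintro ⟨⟨h1, h2⟩, h3⟩
    exact ⟨⟨φ, ⟨e, h1⟩, h2⟩, ⟨h1, h3⟩, rfl⟩

theorem isCompact_Dset (e : E) : IsCompact (Dset e) := by
  have := isCompact_Dset_inter e (isClosed_univ (X := E → Bool))
  rwa [Set.preimage_univ, Set.inter_univ] at this

theorem exists_compactOpen {φ : Spectrum E} {O : Set (Spectrum E)} (hO : IsOpen O) (h : φ ∈ O) :
    ∃ K : Set (Spectrum E), IsOpen K ∧ IsCompact K ∧ φ ∈ K ∧ K ⊆ O := by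
  obtain ⟨O', hO', rfl⟩ := isOpen_induced_iff.1 hO
  obtain ⟨e, he⟩ := φ.2.1
  obtain ⟨V, hV, hφ, hVO⟩ := compact_exists_isClopen_in_isOpen hO' h
  exact ⟨Dset e ∩ Subtype.val ⁻¹' V, (isOpen_Dset e).inter (hV.2.preimage continuous_subtype_val),
    isCompact_Dset_inter e hV.1, ⟨he, hφ⟩, fun x hx => hVO hx.2⟩

end Spectrum

section Action

variable {S : Type*} [RestrictionSemigroup S]

/-- The domain `D_{s*}` of the spectral action of `s`. -/
abbrev Dom (s : S) : Set (Spectrum (Proj S)) := Dset (pr s)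

/-- The spectral action: `(β_s φ)(e) = φ((e s)*)` for `φ` in `D_{s*}`. -/
def act [HasLocalUnits S] (s : S) (φ : Spectrum (Proj S)) (h : φ ∈ Dom s) :
    Spectrum (Proj S) :=
  ⟨fun e => φ.1 (pr ((e : S) * s)), by
    obtain ⟨e, f, he, hf⟩ := HasLocalUnits.exists_units s
    refine ⟨e, ?_⟩
    change φ.1 (pr ((e : S) * s)) = true
    rw [he]
    exact h, fun e f => by
    change φ.1 (pr (((e ⊓ f : Proj S) : S) * s)) = _
    rw [pr_inf_mul, φ.2.2]⟩

theorem Dom_mono {s t : S} (h : s ≤ t) : Dom s ⊆ Dom t := Dset_mono (pr_le h)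

theorem Dom_mul_subset (s t : S) : Dom (s * t) ⊆ Dom t := Dset_mono (pr_mul_le s t)

theorem Dom_mul_dom (s t : S) : Dom (s * dom t) = Dom s ∩ Dom t := by
  change Dset _ = Dset _ ∩ Dset _
  rw [pr_mul_dom, Dset_inf]

/-! ## The universal category: germs of the spectral action -/

/-- Pairs `(s, φ)` with `φ` in the domain of `β_s`. -/
abbrev PreGerm (S : Type*) [RestrictionSemigroup S] : Type _ :=
  {p : S × Spectrum (Proj S) // p.2 ∈ Dom p.1}

/-- `(s, φ) ∼ (t, ψ)` iff `φ = ψ` and there is `u ≤ s, t` with `φ` in `D_{u*}`. -/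
def germSetoid (S : Type*) [RestrictionSemigroup S] : Setoid (PreGerm S) where
  r p q := p.1.2 = q.1.2 ∧ ∃ u : S, u ≤ p.1.1 ∧ u ≤ q.1.1 ∧ p.1.2 ∈ Dom u
  iseqv :=
    { refl := fun p => ⟨rfl, p.1.1, le_rfl, le_rfl, p.2⟩
      symm := fun {p q} ⟨h, u, h1, h2, h3⟩ => ⟨h.symm, u, h2, h1, h ▸ h3⟩
      trans := fun {p q r} ⟨h, u, h1, h2, h3⟩ ⟨k, v, k1, k2, k3⟩ => by
        refine ⟨h.trans k, u * dom v, (mul_dom_le u v).trans h1, ?_, ?_⟩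
        · have e1 : u * dom v = v * dom u := by
            conv_lhs => rw [le_def.1 h2]
            conv_rhs => rw [le_def.1 k1]
            rw [mul_assoc, mul_assoc, dom_comm]
          rw [e1]
          exact (mul_dom_le v u).trans k2
        · rw [Dom_mul_dom]
          exact ⟨h3, h ▸ k3⟩ }

/-- The set of germs `[s, φ]` of the spectral action, that is, the set of arrows of the universal
category of `S`. -/
def Germ (S : Type*) [RestrictionSemigroup S] : Type _ := Quotient (germSetoid S)

/-- The germ `[s, φ]`. -/
def germ (s : S) (φ : Spectrum (Proj S)) (h : φ ∈ Dom s) : Germ S :=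
  Quotient.mk (germSetoid S) ⟨(s, φ), h⟩

theorem germ_eq_iff {s t : S} {φ ψ : Spectrum (Proj S)} {h : φ ∈ Dom s} {k : ψ ∈ Dom t} :
    germ s φ h = germ t ψ k ↔ φ = ψ ∧ ∃ u : S, u ≤ s ∧ u ≤ t ∧ φ ∈ Dom u :=
  Quotient.eq (r := germSetoid S)

theorem germ_ind {p : Germ S → Prop} (h : ∀ s φ k, p (germ s φ k)) (x : Germ S) : p x :=
  Quotient.ind (fun a => h a.1.1 a.1.2 a.2) x

theorem germ_of_le {s t : S} {φ : Spectrum (Proj S)} (h : s ≤ t) (k : φ ∈ Dom s) :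
    germ s φ k = germ t φ (Dom_mono h k) :=
  germ_eq_iff.2 ⟨rfl, s, le_rfl, h, k⟩

/-- The base point `φ` of a germ `[s, φ]`. -/
def pt : Germ S → Spectrum (Proj S) :=
  Quotient.lift (fun p => p.1.2) fun _ _ h => h.1

theorem pt_germ (s : S) (φ : Spectrum (Proj S)) (h : φ ∈ Dom s) : pt (germ s φ h) = φ := rfl

/-- The unit germ `[e, φ]`, where `e` is any projection with `φ e = 1`. -/
noncomputable def unitGerm (φ : Spectrum (Proj S)) : Germ S :=
  germ (φ.2.1.choose : S) φ (by
    change φ.1 (pr _) = true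
    rw [pr_coe]
    exact φ.2.1.choose_spec)

theorem germ_proj (e : Proj S) (φ : Spectrum (Proj S)) (h : φ ∈ Dom (e : S)) :
    germ (e : S) φ h = unitGerm φ := by
  refine germ_eq_iff.2 ⟨rfl, ((e ⊓ φ.2.1.choose : Proj S) : S), ?_, ?_, ?_⟩
  · exact (inf_le_left : e ⊓ φ.2.1.choose ≤ e)
  · exact (inf_le_right : e ⊓ φ.2.1.choose ≤ φ.2.1.choose)
  · change φ ∈ Dset _
    rw [pr_coe, Dset_inf]
    refine ⟨?_, φ.2.1.choose_spec⟩
    rw [← pr_coe e]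
    exact h

theorem pt_unitGerm (φ : Spectrum (Proj S)) : pt (unitGerm φ) = φ := rfl

theorem mem_Dom_dom {s : S} {φ : Spectrum (Proj S)} (h : φ ∈ Dom s) : φ ∈ Dom (dom s) := by
  change φ ∈ Dset _
  rwa [pr_dom]

theorem germ_dom (s : S) (φ : Spectrum (Proj S)) (h : φ ∈ Dom s) :
    germ (dom s) φ (mem_Dom_dom h) = unitGerm φ := germ_proj (pr s) φ _

/-- The domain map `[s, φ] ↦ [s*, φ]`. -/
def gsrc : Germ S → Germ S :=
  Quotient.lift (fun p : PreGerm S => germ (dom p.1.1) p.1.2 (mem_Dom_dom p.2)) (by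
    rintro ⟨⟨s, φ⟩, hs⟩ ⟨⟨t, ψ⟩, ht⟩ ⟨h, -⟩
    obtain rfl : φ = ψ := h
    exact (germ_dom s φ hs).trans (germ_dom t φ ht).symm)

theorem gsrc_eq (x : Germ S) : gsrc x = unitGerm (pt x) :=
  germ_ind (p := fun x => gsrc x = unitGerm (pt x)) (fun s φ h => germ_dom s φ h) x

variable [HasLocalUnits S]

theorem act_congr_of_le {u s : S} (h : u ≤ s) (φ : Spectrum (Proj S)) (hu : φ ∈ Dom u) :
    act u φ hu = act s φ (Dom_mono h hu) := by
  apply Subtype.ext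
  funext e
  change φ.1 (pr ((e : S) * u)) = φ.1 (pr ((e : S) * s))
  have hu' : φ.1 (pr u) = true := hu
  conv_lhs => rw [le_def.1 h]
  rw [← mul_assoc, pr_mul_dom, φ.2.2, hu', Bool.and_true]

/-- The point `β_s(φ)` for a germ `[s, φ]`. -/
def gact : Germ S → Spectrum (Proj S) :=
  Quotient.lift (fun p : PreGerm S => act p.1.1 p.1.2 p.2) (by
    rintro ⟨⟨s, φ⟩, hs⟩ ⟨⟨t, ψ⟩, ht⟩ ⟨h, u, h1, h2, h3⟩
    obtain rfl : φ = ψ := h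
    exact (act_congr_of_le h1 φ h3).symm.trans (act_congr_of_le h2 φ h3))

theorem gact_germ (s : S) (φ : Spectrum (Proj S)) (h : φ ∈ Dom s) :
    gact (germ s φ h) = act s φ h := rfl

/-- The range map `[s, φ] ↦ [e, β_s φ]`, where `e` is a projection with `(β_s φ)(e) = 1`. -/
noncomputable def gtgt (x : Germ S) : Germ S := unitGerm (gact x)

theorem mem_Dom_mul {s t : S} {φ : Spectrum (Proj S)} (h : φ ∈ Dom t) :
    φ ∈ Dom (s * t) ↔ act t φ h ∈ Dom s := by
  have : pr (s * t) = pr (dom s * t) := Subtype.ext (dom_mul s t)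
  change φ.1 (pr (s * t)) = true ↔ φ.1 (pr (dom s * t)) = true
  rw [this]

theorem act_mul (s t : S) (φ : Spectrum (Proj S)) (h : φ ∈ Dom t) (k : act t φ h ∈ Dom s) :
    act s (act t φ h) k = act (s * t) φ ((mem_Dom_mul h).2 k) := by
  apply Subtype.ext
  funext e
  change φ.1 (pr (dom ((e : S) * s) * t)) = φ.1 (pr ((e : S) * (s * t)))
  rw [← mul_assoc]
  have : pr ((e : S) * s * t) = pr (dom ((e : S) * s) * t) := Subtype.ext (dom_mul _ t)
  rw [this]

theorem gsrc_eq_gtgt_iff {x y : Germ S} : gsrc x = gtgt y ↔ pt x = gact y := by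
  rw [gsrc_eq]
  constructor
  · intro h
    have := congrArg pt h
    exact this
  · intro h
    rw [h]
    rfl

theorem exists_rep (x : Germ S) : ∃ (s : S) (h : pt x ∈ Dom s), x = germ s (pt x) h :=
  germ_ind (p := fun x => ∃ (s : S) (h : pt x ∈ Dom s), x = germ s (pt x) h)
    (fun s _ h => ⟨s, h, rfl⟩) x

theorem exists_rep' (x : Germ S) :
    ∃ (s : S) (φ : Spectrum (Proj S)) (h : φ ∈ Dom s), x = germ s φ h :=
  germ_ind (p := fun x => ∃ (s : S) (φ : Spectrum (Proj S)) (h : φ ∈ Dom s), x = germ s φ h)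
    (fun s φ h => ⟨s, φ, h, rfl⟩) x

theorem comp_mem {x y : Germ S} (h : gsrc x = gtgt y) :
    pt y ∈ Dom ((exists_rep x).choose * (exists_rep y).choose) := by
  obtain ⟨hx, ex⟩ := (exists_rep x).choose_spec
  obtain ⟨hy, ey⟩ := (exists_rep y).choose_spec
  rw [mem_Dom_mul hy]
  have : act _ (pt y) hy = gact y := by
    conv_rhs => rw [ey]
    rfl
  rw [this, ← gsrc_eq_gtgt_iff.1 h]
  exact hx

/-- The product `[s, β_t φ] [t, φ] = [s t, φ]`; it is defined by choosing representatives and does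
not depend on them, see `gcomp_germ`. -/
noncomputable def gcomp (x y : Germ S) (h : gsrc x = gtgt y) : Germ S :=
  germ ((exists_rep x).choose * (exists_rep y).choose) (pt y) (comp_mem h)

theorem gcomp_germ (s t : S) (φ : Spectrum (Proj S)) (ht : φ ∈ Dom t) (hs : act t φ ht ∈ Dom s)
    (h : gsrc (germ s (act t φ ht) hs) = gtgt (germ t φ ht)) :
    gcomp (germ s (act t φ ht) hs) (germ t φ ht) h = germ (s * t) φ ((mem_Dom_mul ht).2 hs) := by
  obtain ⟨hx, ex⟩ := (exists_rep (germ s (act t φ ht) hs)).choose_spec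
  obtain ⟨hy, ey⟩ := (exists_rep (germ t φ ht)).choose_spec
  obtain ⟨-, u, u1, u2, u3⟩ := germ_eq_iff.1 ex
  obtain ⟨-, v, v1, v2, v3⟩ := germ_eq_iff.1 ey
  refine germ_eq_iff.2 ⟨rfl, u * v, mul_le_mul_rs u2 v2, mul_le_mul_rs u1 v1, ?_⟩
  rw [pt_germ, mem_Dom_mul v3, act_congr_of_le v1]
  exact u3

theorem gcomp_ind {p : (x y : Germ S) → gsrc x = gtgt y → Prop}
    (hp : ∀ s t φ ht hs h, p (germ s (act t φ ht) hs) (germ t φ ht) h) (x y : Germ S)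
    (h : gsrc x = gtgt y) : p x y h := by
  revert h
  refine germ_ind (p := fun x => ∀ h : gsrc x = gtgt y, p x y h) ?_ x
  intro s ψ hs
  refine germ_ind (p := fun y => ∀ h : gsrc (germ s ψ hs) = gtgt y, p (germ s ψ hs) y h) ?_ y
  intro t φ ht h
  obtain rfl : ψ = act t φ ht := gsrc_eq_gtgt_iff.1 h
  exact hp s t φ ht hs h

theorem act_proj (e : Proj S) (φ : Spectrum (Proj S)) (h : φ ∈ Dom (e : S)) :
    act (e : S) φ h = φ := by
  apply Subtype.ext
  funext f
  change φ.1 (pr ((f : S) * e)) = φ.1 f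
  have h' : φ.1 e = true := by
    rw [← pr_coe e]
    exact h
  rw [← coe_inf, pr_coe, φ.2.2, h', Bool.and_true]

theorem gact_unitGerm (φ : Spectrum (Proj S)) : gact (unitGerm φ) = φ := by
  have h : φ ∈ Dom ((φ.2.1.choose : Proj S) : S) := by
    change φ.1 (pr _) = true
    rw [pr_coe]
    exact φ.2.1.choose_spec
  exact act_proj _ φ h

theorem pt_gcomp (x y : Germ S) (h : gsrc x = gtgt y) : pt (gcomp x y h) = pt y := rfl

theorem gact_gcomp (x y : Germ S) (h : gsrc x = gtgt y) : gact (gcomp x y h) = gact x := by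
  refine gcomp_ind (p := fun x y h => gact (gcomp x y h) = gact x) ?_ x y h
  intro s t φ ht hs h
  rw [gcomp_germ, gact_germ, gact_germ, act_mul]

theorem gcomp_congr {x x' y y' : Germ S} (hx : x = x') (hy : y = y') (h : gsrc x = gtgt y)
    (h' : gsrc x' = gtgt y') : gcomp x y h = gcomp x' y' h' := by
  subst hx hy
  rfl

theorem gcomp_germ' (s t : S) (φ ψ : Spectrum (Proj S)) (ht : φ ∈ Dom t) (hs : ψ ∈ Dom s)
    (h : gsrc (germ s ψ hs) = gtgt (germ t φ ht)) :
    ∃ k, gcomp (germ s ψ hs) (germ t φ ht) h = germ (s * t) φ k := by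
  obtain rfl : ψ = act t φ ht := gsrc_eq_gtgt_iff.1 h
  exact ⟨_, gcomp_germ s t φ ht hs h⟩

theorem germ_congr {s t : S} (h : s = t) (φ : Spectrum (Proj S)) (k : φ ∈ Dom s)
    (k' : φ ∈ Dom t) : germ s φ k = germ t φ k' := by
  subst h
  rfl

/-- The category of germs of the spectral action. -/
noncomputable instance : ArrowCat (Germ S) where
  src := gsrc
  tgt := gtgt
  comp := gcomp
  src_src x := by rw [gsrc_eq, gsrc_eq, pt_unitGerm]
  tgt_src x := by rw [gtgt, gsrc_eq, gact_unitGerm]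
  src_tgt x := by rw [gsrc_eq, gtgt, pt_unitGerm]
  tgt_tgt x := by rw [gtgt, gtgt, gact_unitGerm]
  src_comp x y h := by rw [gsrc_eq, gsrc_eq, pt_gcomp]
  tgt_comp x y h := by rw [gtgt, gtgt, gact_gcomp]
  comp_assoc x y z h k := by
    obtain ⟨s, φ, hs, rfl⟩ := exists_rep' x
    obtain ⟨t, ψ, ht, rfl⟩ := exists_rep' y
    obtain ⟨u, χ, hu, rfl⟩ := exists_rep' z
    obtain ⟨k1, e1⟩ := gcomp_germ' s t ψ φ ht hs h
    obtain ⟨k2, e2⟩ := gcomp_germ' t u χ ψ hu ht k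
    have l1 : gsrc (germ (s * t) ψ k1) = gtgt (germ u χ hu) := by
      rw [← k, gsrc_eq, gsrc_eq]
      rfl
    have l2 : gsrc (germ s φ hs) = gtgt (germ (t * u) χ k2) := by
      rw [← e2, h, gtgt, gtgt, gact_gcomp]
    rw [gcomp_congr e1 rfl _ l1, gcomp_congr rfl e2 _ l2]
    obtain ⟨k3, e3⟩ := gcomp_germ' (s * t) u χ ψ hu k1 l1
    obtain ⟨k4, e4⟩ := gcomp_germ' s (t * u) χ φ k2 hs l2
    rw [e3, e4]
    exact germ_congr (mul_assoc s t u) χ _ _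
  tgt_comp_self x := by
    obtain ⟨s, φ, hs, rfl⟩ := exists_rep' x
    let e : Proj S := (gact (germ s φ hs)).2.1.choose
    obtain ⟨k, hk⟩ := gcomp_germ' (e : S) s φ _ hs _
      (by rw [gsrc_eq]; rfl : gsrc (unitGerm (gact (germ s φ hs))) = gtgt (germ s φ hs))
    refine hk.trans ?_
    refine germ_of_le ?_ k
    have h : (e : S) * s = s * dom ((e : S) * s) := by
      conv_lhs => rw [← proj_dom e]
      exact dom_mul_eq _ _
    rw [h]
    exact mul_dom_le _ _
  comp_src_self x := by
    obtain ⟨s, φ, hs, rfl⟩ := exists_rep' x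
    have hh : gsrc (germ s φ hs) = gtgt (gsrc (germ s φ hs)) := by
      rw [gtgt, gsrc_eq, gact_unitGerm]
    obtain ⟨k, hk⟩ := gcomp_germ' s (dom s) φ φ (mem_Dom_dom hs) hs hh
    refine hk.trans ?_
    exact germ_of_le (mul_dom_le s s) k

/-- The set `(s, U) = {[s, φ] : φ ∈ U}`. -/
def basicSlice (s : S) (U : Set (Spectrum (Proj S))) : Set (Germ S) :=
  {x | ∃ (φ : Spectrum (Proj S)) (h : φ ∈ Dom s), φ ∈ U ∧ x = germ s φ h}

/-- The topology of the universal category, generated by the sets `(s, U)` with `s ∈ S` and `U` an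
open subset of `D_{s*}`. -/
instance : TopologicalSpace (Germ S) :=
  TopologicalSpace.generateFrom {W | ∃ (s : S) (U : Set (Spectrum (Proj S))),
    IsOpen U ∧ U ⊆ Dom s ∧ W = basicSlice s U}

theorem isOpen_basicSlice (s : S) {U : Set (Spectrum (Proj S))} (hU : IsOpen U)
    (h : U ⊆ Dom s) : IsOpen (basicSlice s U) :=
  TopologicalSpace.isOpen_generateFrom_of_mem ⟨s, U, hU, h, rfl⟩

/-- The set of `φ` with `[s, φ] ∈ O`. -/
def trace (s : S) (O : Set (Germ S)) : Set (Spectrum (Proj S)) :=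
  {φ | ∃ h : φ ∈ Dom s, germ s φ h ∈ O}

theorem trace_subset (s : S) (O : Set (Germ S)) : trace s O ⊆ Dom s := fun _ h => h.1

theorem isOpen_trace (s : S) {O : Set (Germ S)} (hO : IsOpen O) : IsOpen (trace s O) := by
  induction hO with
  | basic W hW =>
    obtain ⟨t, U, hU, hUt, rfl⟩ := hW
    have : trace s (basicSlice t U) = U ∩ ⋃ u ∈ {u : S | u ≤ s ∧ u ≤ t}, Dom u := by
      ext φ
      simp only [Set.mem_inter_iff, Set.mem_iUnion, Set.mem_ofPred_eq]
      constructor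
      · rintro ⟨h, ψ, k, hψ, e⟩
        obtain ⟨rfl, u, h1, h2, h3⟩ := germ_eq_iff.1 e
        exact ⟨hψ, u, ⟨h1, h2⟩, h3⟩
      · rintro ⟨hφ, u, ⟨h1, h2⟩, h3⟩
        exact ⟨Dom_mono h1 h3, φ, hUt hφ, hφ, germ_eq_iff.2 ⟨rfl, u, h1, h2, h3⟩⟩
    rw [this]
    exact hU.inter (isOpen_biUnion fun u _ => isOpen_Dset _)
  | univ =>
    have : trace s (Set.univ : Set (Germ S)) = Dom s := by
      ext φ
      exact ⟨fun h => h.1, fun h => ⟨h, trivial⟩⟩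
    rw [this]
    exact isOpen_Dset _
  | inter A B _ _ hA hB =>
    have : trace s (A ∩ B) = trace s A ∩ trace s B := by
      ext φ
      exact ⟨fun ⟨h, k⟩ => ⟨⟨h, k.1⟩, ⟨h, k.2⟩⟩, fun ⟨⟨h, k⟩, ⟨_, l⟩⟩ => ⟨h, k, l⟩⟩
    rw [this]
    exact hA.inter hB
  | sUnion F _ hF =>
    have : trace s (⋃₀ F) = ⋃ A ∈ F, trace s A := by
      ext φ
      simp only [Set.mem_iUnion]
      exact ⟨fun ⟨h, A, hA, k⟩ => ⟨A, hA, h, k⟩, fun ⟨A, hA, h, k⟩ => ⟨h, A, hA, k⟩⟩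
    rw [this]
    exact isOpen_biUnion hF

theorem isOpen_of_trace {O : Set (Germ S)} (h : ∀ s, IsOpen (trace s O)) : IsOpen O := by
  have : O = ⋃ s, basicSlice s (trace s O) := by
    ext x
    refine germ_ind (p := fun x => x ∈ O ↔ x ∈ ⋃ s, basicSlice s (trace s O)) ?_ x
    intro s φ k
    simp only [Set.mem_iUnion]
    constructor
    · intro hx
      exact ⟨s, φ, k, ⟨k, hx⟩, rfl⟩
    · rintro ⟨t, ψ, l, ⟨_, hO⟩, e⟩
      rw [e]
      exact hO
  rw [this]
  exact isOpen_iUnion fun s => isOpen_basicSlice s (h s) (trace_subset s O)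

theorem continuous_unitGerm : Continuous (unitGerm : Spectrum (Proj S) → Germ S) := by
  refine ⟨fun O hO => ?_⟩
  have : unitGerm ⁻¹' O = ⋃ e : Proj S, trace (e : S) O := by
    ext φ
    simp only [Set.mem_iUnion]
    constructor
    · intro h
      exact ⟨φ.2.1.choose, _, h⟩
    · rintro ⟨e, h, k⟩
      rw [germ_proj] at k
      exact k
  rw [this]
  exact isOpen_iUnion fun e => isOpen_trace _ hO

theorem continuous_pt : Continuous (pt : Germ S → Spectrum (Proj S)) := by
  refine ⟨fun O hO => isOpen_of_trace fun s => ?_⟩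
  have : trace s (pt ⁻¹' O) = Dom s ∩ O := by
    ext φ
    exact ⟨fun ⟨h, k⟩ => ⟨h, k⟩, fun ⟨h, k⟩ => ⟨h, k⟩⟩
  rw [this]
  exact (isOpen_Dset _).inter hO

theorem continuous_gact : Continuous (gact : Germ S → Spectrum (Proj S)) := by
  refine Continuous.subtype_mk (f := fun x : Germ S => (gact x).1) ?_ (fun x => (gact x).2)
  refine continuous_pi fun e => ?_
  refine ⟨fun O _ => isOpen_of_trace fun s => ?_⟩
  have : trace s ((fun x : Germ S => (gact x).1 e) ⁻¹' O) =
      Dom s ∩ (fun φ : Spectrum (Proj S) => φ.1 (pr ((e : S) * s))) ⁻¹' O := by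
    ext φ
    exact ⟨fun ⟨h, k⟩ => ⟨h, k⟩, fun ⟨h, k⟩ => ⟨h, k⟩⟩
  rw [this]
  exact (isOpen_Dset _).inter ((isOpen_discrete O).preimage (continuous_eval _))

instance : IsTopologicalCat (Germ S) where
  continuous_src := by
    have : (src : Germ S → Germ S) = unitGerm ∘ pt := funext gsrc_eq
    rw [this]
    exact continuous_unitGerm.comp continuous_pt
  continuous_tgt := continuous_unitGerm.comp continuous_gact
  continuous_comp := by
    refine ⟨fun O hO => ?_⟩
    rw [isOpen_iff_forall_mem_open]
    rintro ⟨⟨x, y⟩, h⟩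
    change gcomp x y h ∈ O → _
    refine gcomp_ind (p := fun x y h => gcomp x y h ∈ O → ∃ t ⊆ (fun p : {p : Germ S × Germ S //
      gsrc p.1 = gtgt p.2} => gcomp p.1.1 p.1.2 p.2) ⁻¹' O, IsOpen t ∧ ⟨(x, y), h⟩ ∈ t) ?_ x y h
    intro s t φ ht hs h hO'
    rw [gcomp_germ] at hO'
    refine ⟨Subtype.val ⁻¹' (basicSlice s (Dom s) ×ˢ basicSlice t (trace (s * t) O)), ?_, ?_, ?_⟩
    · rintro ⟨⟨x', y'⟩, h'⟩ ⟨⟨ψ, hψ, -, ex⟩, ⟨χ, hχ, ⟨k, hO''⟩, ey⟩⟩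
      change x' = _ at ex
      change y' = _ at ey
      subst ex ey
      change gcomp _ _ _ ∈ O
      obtain ⟨_, e⟩ := gcomp_germ' s t χ ψ hχ hψ h'
      rw [e]
      exact hO''
    · exact ((isOpen_basicSlice s (isOpen_Dset _) subset_rfl).prod
        (isOpen_basicSlice t (isOpen_trace _ hO)
          ((trace_subset _ _).trans (Dom_mul_subset s t)))).preimage continuous_subtype_val
    · exact ⟨⟨_, hs, hs, rfl⟩, ⟨φ, ht, ⟨_, hO'⟩, rfl⟩⟩

theorem injOn_basicSlice (s : S) (U : Set (Spectrum (Proj S))) :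
    Set.InjOn (src : Germ S → Germ S) (basicSlice s U) := by
  rintro _ ⟨φ, h, -, rfl⟩ _ ⟨ψ, k, -, rfl⟩ e
  obtain rfl : φ = ψ := (germ_eq_iff.1 e).1
  rfl

theorem isOpenMap_srcU : IsOpenMap (srcU : Germ S → units (Germ S)) := by
  intro O hO
  refine ⟨⋃ s, basicSlice (dom s) (trace s O), isOpen_iUnion fun s =>
    isOpen_basicSlice _ (isOpen_trace s hO) fun φ h => mem_Dom_dom h.1, ?_⟩
  ext x
  simp only [Set.mem_preimage, Set.mem_iUnion]
  constructor
  · rintro ⟨s, φ, h, ⟨k, hO'⟩, e⟩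
    exact ⟨germ s φ k, hO', Subtype.ext e.symm⟩
  · rintro ⟨y, hy, rfl⟩
    obtain ⟨s, hs, ey⟩ := exists_rep y
    refine ⟨s, pt y, mem_Dom_dom hs, ⟨hs, ?_⟩, ?_⟩
    · rwa [← ey]
    · change gsrc y = _
      conv_lhs => rw [ey]
      rfl

theorem isCompact_basicSlice (s : S) {K : Set (Spectrum (Proj S))} (hK : IsCompact K)
    (h : K ⊆ Dom s) : IsCompact (basicSlice s K) := by
  have hc : Continuous fun φ : Dom s => germ s φ.1 φ.2 := by
    refine ⟨fun O hO => ⟨trace s O, isOpen_trace s hO, ?_⟩⟩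
    ext φ
    exact ⟨fun ⟨_, k⟩ => k, fun k => ⟨φ.2, k⟩⟩
  have hK' : IsCompact (Subtype.val ⁻¹' K : Set (Dom s)) := by
    rw [Subtype.isCompact_iff, Subtype.image_preimage_coe, Set.inter_eq_self_of_subset_right h]
    exact hK
  convert hK'.image hc using 1
  ext x
  constructor
  · rintro ⟨φ, k, hφ, rfl⟩
    exact ⟨⟨φ, k⟩, hφ, rfl⟩
  · rintro ⟨⟨φ, k⟩, hφ, rfl⟩
    exact ⟨φ, k, hφ, rfl⟩

instance : IsEtale (Germ S) where
  hausdorff := by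
    refine T2Space.of_injective_continuous (f := fun x : units (Germ S) => pt x.1) ?_
      (continuous_pt.comp continuous_subtype_val)
    rintro ⟨_, x, rfl⟩ ⟨_, y, rfl⟩ h
    apply Subtype.ext
    change pt (gsrc x) = pt (gsrc y) at h
    change gsrc x = gsrc y
    rw [gsrc_eq, gsrc_eq, pt_unitGerm, pt_unitGerm] at h
    rw [gsrc_eq, gsrc_eq, h]
  locallyCompact := by
    have : T2Space (units (Germ S)) := by
      refine T2Space.of_injective_continuous (f := fun x : units (Germ S) => pt x.1) ?_
        (continuous_pt.comp continuous_subtype_val)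
      rintro ⟨_, x, rfl⟩ ⟨_, y, rfl⟩ h
      apply Subtype.ext
      change pt (gsrc x) = pt (gsrc y) at h
      change gsrc x = gsrc y
      rw [gsrc_eq, gsrc_eq, pt_unitGerm, pt_unitGerm] at h
      rw [gsrc_eq, gsrc_eq, h]
    have : WeaklyLocallyCompactSpace (units (Germ S)) := by
      refine ⟨?_⟩
      rintro ⟨_, x, rfl⟩
      obtain ⟨s, hs, ex⟩ := exists_rep x
      have hsrc : Continuous (srcU : Germ S → units (Germ S)) :=
        (IsTopologicalCat.continuous_src (C := Germ S)).subtype_mk _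
      refine ⟨srcU '' basicSlice s (Dom s),
        (isCompact_basicSlice s (isCompact_Dset _) subset_rfl).image hsrc, ?_⟩
      exact (isOpenMap_srcU _ (isOpen_basicSlice s (isOpen_Dset _) subset_rfl)).mem_nhds
        ⟨x, ⟨pt x, hs, hs, ex⟩, rfl⟩
    infer_instance
  localHomeo := by
    rw [isLocalHomeomorph_iff_isOpenEmbedding_restrict]
    intro x
    obtain ⟨s, hs, ex⟩ := exists_rep x
    have ho : IsOpen (basicSlice s (Dom s)) := isOpen_basicSlice s (isOpen_Dset _) subset_rfl
    refine ⟨basicSlice s (Dom s), ho.mem_nhds ⟨pt x, hs, hs, ex⟩, ?_⟩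
    refine Topology.IsOpenEmbedding.of_continuous_injective_isOpenMap ?_ ?_
      (isOpenMap_srcU.comp ho.isOpenMap_subtype_val)
    · exact ((IsTopologicalCat.continuous_src (C := Germ S)).subtype_mk _).comp
        continuous_subtype_val
    · rintro ⟨y, hy⟩ ⟨z, hz⟩ h
      exact Subtype.ext (injOn_basicSlice s _ hy hz (congrArg Subtype.val h))

theorem isSlice_basicSlice (s : S) {U : Set (Spectrum (Proj S))} (hU : IsOpen U)
    (h : U ⊆ Dom s) : IsSlice (basicSlice s U) :=
  isSlice_iff.2 ⟨isOpen_basicSlice s hU h, injOn_basicSlice s U⟩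

instance : IsAmple (Germ S) where
  isBasis := by
    refine TopologicalSpace.isTopologicalBasis_of_isOpen_of_nhds (fun U hU => hU.1.isOpen) ?_
    intro x O hx hO
    obtain ⟨s, hs, ex⟩ := exists_rep x
    have hx' : pt x ∈ trace s O := by
      refine ⟨hs, ?_⟩
      rwa [← ex]
    obtain ⟨K, h1, h2, h3, h4⟩ := exists_compactOpen (isOpen_trace s hO) hx'
    have hK := h4.trans (trace_subset s O)
    refine ⟨basicSlice s K, ⟨isSlice_basicSlice s h1 hK, isCompact_basicSlice s h2 hK⟩,
      ⟨pt x, hs, h3, ex⟩, ?_⟩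
    rintro _ ⟨φ, k, hφ, rfl⟩
    exact (h4 hφ).2

end Action

/-! ## The universal Booleanization -/

/-- The universal Booleanization `B(S)` of a restriction semigroup `S` with local units: the Boolean
restriction semigroup of compact slices of the universal category of `S`. -/
abbrev Booleanization (S : Type*) [RestrictionSemigroup S] [HasLocalUnits S] : Type _ :=
  CompactSlice (Germ S)

/-- The canonical morphism `ι : S → B(S)`, `ι s = (s, D_{s*})`. -/
def toBooleanization (S : Type*) [RestrictionSemigroup S] [HasLocalUnits S] :
    RestrictionHom S (Booleanization S) where
  toFun s := ⟨basicSlice s (Dom s), isSlice_basicSlice s (isOpen_Dset _) subset_rfl,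
    isCompact_basicSlice s (isCompact_Dset _) subset_rfl⟩
  map_mul s t := by
    apply Subtype.ext
    change basicSlice (s * t) (Dom (s * t)) = setMul (basicSlice s (Dom s)) (basicSlice t (Dom t))
    ext x
    constructor
    · rintro ⟨φ, h, -, rfl⟩
      have ht : φ ∈ Dom t := Dom_mul_subset s t h
      have hs := (mem_Dom_mul ht).1 h
      have hh : gsrc (germ s (act t φ ht) hs) = gtgt (germ t φ ht) := gsrc_eq_gtgt_iff.2 rfl
      exact ⟨_, ⟨_, hs, hs, rfl⟩, _, ⟨φ, ht, ht, rfl⟩, hh, gcomp_germ s t φ ht hs hh⟩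
    · rintro ⟨_, ⟨ψ, hs, -, rfl⟩, _, ⟨φ, ht, -, rfl⟩, h, rfl⟩
      obtain ⟨k, e⟩ := gcomp_germ' s t φ ψ ht hs h
      exact ⟨φ, k, k, e⟩
  map_dom s := by
    apply Subtype.ext
    change basicSlice (dom s) (Dom (dom s)) = gsrc '' basicSlice s (Dom s)
    ext x
    constructor
    · rintro ⟨φ, h, -, rfl⟩
      have hs : φ ∈ Dom s := by
        have h' : φ ∈ Dset (pr (dom s)) := h
        rwa [pr_dom] at h'
      exact ⟨germ s φ hs, ⟨φ, hs, hs, rfl⟩, rfl⟩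
    · rintro ⟨_, ⟨φ, h, -, rfl⟩, rfl⟩
      exact ⟨φ, mem_Dom_dom h, mem_Dom_dom h, rfl⟩

end UnivBool

/-! Call a character of `P(T)` prime if it preserves the least element and binary joins; prime
characters are the points of the Stone space of `P(T)`. Elements of `T` are determined by their
germs at these points: if every germ of `s` at a prime character is also a germ of `t`, then `s ≤ t`
(`le_of_sameGerm`). Indeed the projections `e` with `s e ≤ t` form an ideal. If it misses `s*`, the
prime ideal theorem yields a prime character that vanishes on the ideal and is `1` at `s*`, yet a
common lower bound `u` of `s` and `t` defined there has `u*` in the ideal.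

A prime character `χ` pulls back to the character `χ ∘ α` of `P(S)`, unless that map is zero. A
compact slice `U` therefore prescribes germs over `T`: the germ of `α s` at `χ` whenever `[s, χ ∘ α]
∈ U`. The relation `Realizes` says that `t` has exactly the prescribed germs, so each `U` is
realized by at most one `t`.

For existence, `U` contains around each of its points a basic slice `(s, K)` with `K` cut out by
finitely many values of characters. Meets and relative complements in `P(T)` encode these conditions
in a projection `q`, and `α(s) q` realizes `(s, K)`. Compactness leaves finitely many pieces. Since
the domain map is injective on `U`, their realizing elements are compatible, and joins of these
realize unions.

Let `ψ U` be the element realizing `U`. Products, domains and unions of realized sets are realized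
by products, domains and joins, so uniqueness makes `ψ` a morphism. It extends `α` because `α s`
realizes `ι s`, and non-degeneracy passes from `α` to `ψ`. -/

namespace UnivBool

open RestrictionSemigroup ArrowCat

/-! ## Projections of a Boolean restriction semigroup -/

section BooleanProj

variable {T : Type*} [RestrictionSemigroup T] [BooleanRestrictionSemigroup T]

/-- The generalized Boolean algebra of projections of a Boolean restriction semigroup. Its meet is
the product of projections. -/
noncomputable instance : GeneralizedBooleanAlgebra (Proj T) :=
  let h : IsGenBoolAlg (Proj T) := BooleanRestrictionSemigroup.proj_genBoolAlg
  let B := h.choose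
  have hle : ∀ x y : Proj T, B.le x y ↔ x ≤ y := h.choose_spec
  have hinf : ∀ x y : Proj T, B.inf x y = x ⊓ y := fun x y =>
    le_antisymm (le_inf ((hle _ _).1 (B.inf_le_left x y)) ((hle _ _).1 (B.inf_le_right x y)))
      ((hle _ _).1 (B.le_inf _ _ _ ((hle _ _).2 inf_le_left) ((hle _ _).2 inf_le_right)))
  -- The meet is kept definitionally equal to the product of projections; only joins, differences
  -- and the least element come from the chosen algebra.
  { (inferInstance : SemilatticeInf (Proj T)) with
    sup := B.sup
    le_sup_left := fun x y => (hle _ _).1 (B.le_sup_left x y)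
    le_sup_right := fun x y => (hle _ _).1 (B.le_sup_right x y)
    sup_le := fun x y z hx hy => (hle _ _).1 (B.sup_le _ _ _ ((hle _ _).2 hx) ((hle _ _).2 hy))
    le_sup_inf := fun x y z => by
      rw [← hinf, ← hinf]
      exact (hle _ _).1 (B.le_sup_inf x y z)
    sdiff := B.sdiff
    bot := B.bot
    sup_inf_sdiff := fun x y => by
      have := B.sup_inf_sdiff x y
      rw [← hinf]
      exact this
    inf_inf_sdiff := fun x y => by
      have := B.inf_inf_sdiff x y
      rw [← hinf, ← hinf]
      exact this }

/-- The zero `z` of `T` is a projection with `z = ⊥ z`, so it lies below `⊥` and coincides with it.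
-/
theorem coe_bot_isZero (t : T) : ((⊥ : Proj T) : T) * t = ((⊥ : Proj T) : T) ∧
    t * ((⊥ : Proj T) : T) = ((⊥ : Proj T) : T) := by
  obtain ⟨z, hz, h⟩ := BooleanRestrictionSemigroup.exists_zero (S := T)
  have hb : (⊥ : Proj T) = pr z := by
    refine le_antisymm bot_le ?_
    change dom z = ((⊥ : Proj T) : T) * dom (dom z)
    rw [dom_dom, hz, (h _).2]
  have : ((⊥ : Proj T) : T) = z := by
    rw [hb]
    exact hz
  rw [this]
  exact h t

theorem coe_bot_le (t : T) : ((⊥ : Proj T) : T) ≤ t := by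
  rw [le_def, proj_dom, (coe_bot_isZero t).2]

/-- Restricting `j` to the projection `s* ∨ t*` still leaves an upper bound of `s` and `t`, so `j`
lies below that restriction and its domain below `s* ∨ t*`. -/
theorem pr_eq_sup_of_isLUB {s t j : T} (h : IsLUB {s, t} j) : pr j = pr s ⊔ pr t := by
  have hs : s ≤ j := h.1 (Set.mem_insert _ _)
  have ht : t ≤ j := h.1 (Set.mem_insert_of_mem _ rfl)
  refine le_antisymm ?_ (sup_le (pr_le hs) (pr_le ht))
  have key : ∀ r : T, r ≤ j → pr r ≤ pr s ⊔ pr t →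
      r ≤ j * dom ((pr s ⊔ pr t : Proj T) : T) := by
    intro r hr hle
    rw [le_def, mul_assoc, proj_dom]
    have : ((pr s ⊔ pr t : Proj T) : T) * dom r = dom r :=
      congrArg Subtype.val (inf_eq_right.2 hle)
    rw [this]
    exact le_def.1 hr
  have hj : j ≤ j * dom ((pr s ⊔ pr t : Proj T) : T) := by
    refine h.2 ?_
    rintro x (rfl | rfl)
    · exact key _ hs le_sup_left
    · exact key _ ht le_sup_right
  have := pr_le hj
  rw [pr_mul_dom, pr_coe] at this
  exact this.trans inf_le_right

theorem compatible_of_le {a b c : T} (ha : a ≤ c) (hb : b ≤ c) : Compatible a b := by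
  change a * dom b = b * dom a
  conv_lhs => rw [le_def.1 ha]
  conv_rhs => rw [le_def.1 hb]
  rw [mul_assoc, mul_assoc, dom_comm]

/-- Elements below `c` are determined by their domains. The join of `a` and `b`, which exists by
compatibility, lies below `c` and has the same domain as `c`. -/
theorem isLUB_of_pr_sup_eq {a b c : T} (ha : a ≤ c) (hb : b ≤ c) (h : pr a ⊔ pr b = pr c) :
    IsLUB {a, b} c := by
  obtain ⟨m, hm⟩ := BooleanRestrictionSemigroup.exists_join a b (compatible_of_le ha hb)
  have hmc : m ≤ c := by
    refine hm.2 ?_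
    rintro x (rfl | rfl)
    · exact ha
    · exact hb
  have hd : dom m = dom c := congrArg Subtype.val ((pr_eq_sup_of_isLUB hm).trans h)
  have : m = c := by rw [le_def.1 hmc, hd, mul_dom]
  rwa [← this]

/-- The axiom on joins only concerns multiplication on the right. Distributing `s` from the left
over a join of projections follows instead by comparing domains, using distributivity of `P(T)`. -/
theorem isLUB_mul_proj (s : T) (e f : Proj T) :
    IsLUB {s * (e : T), s * (f : T)} (s * ((e ⊔ f : Proj T) : T)) := by
  have hpr : ∀ g : Proj T, pr (s * (g : T)) = pr s ⊓ g := fun g => by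
    rw [← proj_dom g, pr_mul_dom, pr_coe]
  refine isLUB_of_pr_sup_eq (mul_le_mul_rs le_rfl (le_sup_left : e ≤ e ⊔ f))
    (mul_le_mul_rs le_rfl (le_sup_right : f ≤ e ⊔ f)) ?_
  rw [hpr, hpr, hpr, inf_sup_left]

/-- A join in `P(T)` is thus also least among upper bounds in all of `T`, as is needed to apply the
axioms on joins to it. -/
theorem isLUB_coe_proj (e f : Proj T) :
    IsLUB {(e : T), (f : T)} ((e ⊔ f : Proj T) : T) := by
  refine isLUB_of_pr_sup_eq (le_sup_left : e ≤ e ⊔ f) (le_sup_right : f ≤ e ⊔ f) ?_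
  rw [pr_coe, pr_coe, pr_coe]

/-! ## Prime characters -/

/-- A character of a generalized Boolean algebra of projections is prime if it preserves the
least element and binary joins. -/
structure IsPrimeChar (χ : Spectrum (Proj T)) : Prop where
  map_bot : χ.1 ⊥ = false
  map_sup : ∀ a b, χ.1 (a ⊔ b) = (χ.1 a || χ.1 b)

theorem IsPrimeChar.map_sdiff {χ : Spectrum (Proj T)} (hχ : IsPrimeChar χ) (a b : Proj T) :
    χ.1 (a \ b) = (χ.1 a && !χ.1 b) := by
  have h1 := congrArg χ.1 (sup_inf_sdiff a b)
  have h2 := congrArg χ.1 (inf_inf_sdiff a b)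
  have h3 := congrArg χ.1 (inf_eq_left.2 (sdiff_le : a \ b ≤ a))
  have h4 := congrArg χ.1 (disjoint_iff.1 (disjoint_sdiff_self_left : Disjoint (a \ b) b))
  rw [hχ.map_sup, χ.2.2] at h1
  rw [χ.2.2] at h3
  rw [χ.2.2, hχ.map_bot] at h4
  revert h1 h3 h4
  cases χ.1 a <;> cases χ.1 b <;> cases χ.1 (a \ b) <;> simp

/-- The prime ideal theorem for distributive lattices separates `I` from the principal filter of
`e`; the character is the indicator function of the complement of the prime ideal. -/
theorem exists_primeChar {I : Order.Ideal (Proj T)} {e : Proj T} (he : e ∉ I) :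
    ∃ χ : Spectrum (Proj T), IsPrimeChar χ ∧ χ.1 e = true ∧ ∀ a ∈ I, χ.1 a = false := by
  classical
  have hd : Disjoint (Order.PFilter.principal e : Set (Proj T)) (I : Set (Proj T)) := by
    rw [Set.disjoint_left]
    intro a ha haI
    exact he (I.lower (Order.PFilter.mem_principal.1 ha) haI)
  obtain ⟨J, hJ, hIJ, hFJ⟩ := DistribLattice.prime_ideal_of_disjoint_filter_ideal hd
  have heJ : e ∉ J := fun h =>
    Set.disjoint_left.1 hFJ (Order.PFilter.mem_principal.2 le_rfl) h
  refine ⟨⟨fun a => decide (a ∉ J), ⟨e, by simpa using heJ⟩, fun a b => ?_⟩, ⟨?_, fun a b => ?_⟩,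
    by simpa using heJ, fun a ha => by simpa using hIJ ha⟩
  · have : a ⊓ b ∈ J ↔ a ∈ J ∨ b ∈ J :=
      ⟨fun h => hJ.mem_or_mem h, fun h => h.elim (J.lower inf_le_left) (J.lower inf_le_right)⟩
    by_cases ha : a ∈ J <;> by_cases hb : b ∈ J <;> simp [this, ha, hb]
  · simp
  · by_cases ha : a ∈ J <;> by_cases hb : b ∈ J <;> simp [ha, hb]

/-- By right distributivity of products over joins, `e ↦ (e t)*` preserves joins. Prime characters
are therefore stable under the spectral action, so that products can be tested on prime characters
alone. -/
theorem IsPrimeChar.act [HasLocalUnits T] {χ : Spectrum (Proj T)} (hχ : IsPrimeChar χ) (t : T)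
    (h : χ ∈ Dom t) : IsPrimeChar (act t χ h) where
  map_bot := by
    change χ.1 (pr (((⊥ : Proj T) : T) * t)) = false
    rw [(coe_bot_isZero t).1, pr_coe, hχ.map_bot]
  map_sup a b := by
    change χ.1 (pr (((a ⊔ b : Proj T) : T) * t)) = (χ.1 (pr ((a : T) * t)) || χ.1 (pr ((b : T) * t)))
    rw [← hχ.map_sup, ← pr_eq_sup_of_isLUB
      (BooleanRestrictionSemigroup.join_mul _ _ t _ (isLUB_coe_proj a b))]

end BooleanProj

/-! ## Equality of germs of elements -/

section SameGerm

variable {T : Type*} [RestrictionSemigroup T]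

/-- The elements `s` and `t` are both defined at `χ` and have the same germ there. -/
def SameGerm (χ : Spectrum (Proj T)) (s t : T) : Prop := ∃ u ≤ s, u ≤ t ∧ χ ∈ Dom u

variable {χ : Spectrum (Proj T)} {r s t : T}

theorem SameGerm.left (h : SameGerm χ s t) : χ ∈ Dom s :=
  let ⟨_, hs, _, hu⟩ := h
  Dom_mono hs hu

theorem SameGerm.right (h : SameGerm χ s t) : χ ∈ Dom t :=
  let ⟨_, _, ht, hu⟩ := h
  Dom_mono ht hu

theorem SameGerm.symm (h : SameGerm χ s t) : SameGerm χ t s :=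
  let ⟨u, hs, ht, hu⟩ := h
  ⟨u, ht, hs, hu⟩

theorem SameGerm.of_le (h : s ≤ t) (k : χ ∈ Dom s) : SameGerm χ s t := ⟨s, le_rfl, h, k⟩

theorem sameGerm_iff (hs : χ ∈ Dom s) (ht : χ ∈ Dom t) :
    SameGerm χ s t ↔ germ s χ hs = germ t χ ht := by
  rw [germ_eq_iff]
  exact ⟨fun h => ⟨rfl, h⟩, fun h => h.2⟩

theorem SameGerm.trans (h : SameGerm χ r s) (k : SameGerm χ s t) : SameGerm χ r t := by
  rw [sameGerm_iff h.left k.right]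
  exact ((sameGerm_iff h.left h.right).1 h).trans ((sameGerm_iff h.right k.right).1 k)

theorem SameGerm.dom (h : SameGerm χ s t) : SameGerm χ (dom s) (dom t) := by
  obtain ⟨u, hs, ht, hu⟩ := h
  exact ⟨_, pr_le hs, pr_le ht, mem_Dom_dom hu⟩

theorem SameGerm.act_eq [HasLocalUnits T] (h : SameGerm χ s t) :
    act s χ h.left = act t χ h.right := by
  obtain ⟨u, hs, ht, hu⟩ := h
  rw [← act_congr_of_le hs χ hu, ← act_congr_of_le ht χ hu]

theorem SameGerm.mul [HasLocalUnits T] {s' t' : T} (h : SameGerm χ s t)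
    (k : SameGerm (act s χ h.left) s' t') : SameGerm χ (s' * s) (t' * t) := by
  obtain ⟨u, hs, ht, hu⟩ := h
  obtain ⟨v, hs', ht', hv⟩ := k
  refine ⟨v * u, mul_le_mul_rs hs' hs, mul_le_mul_rs ht' ht, (mem_Dom_mul hu).2 ?_⟩
  rwa [act_congr_of_le hs χ hu]

/-- A failure of `s ≤ t` is visible at a single prime character, one that avoids the ideal of
projections on which `s` restricts to something below `t`. -/
theorem le_of_sameGerm [BooleanRestrictionSemigroup T]
    (h : ∀ χ : Spectrum (Proj T), IsPrimeChar χ → χ ∈ Dom s → SameGerm χ s t) : s ≤ t := by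
  let I : Order.Ideal (Proj T) :=
    { carrier := {e | s * (e : T) ≤ t}
      lower' := fun e f hfe he => (mul_le_mul_rs le_rfl hfe).trans he
      nonempty' := by
        refine ⟨⊥, ?_⟩
        change s * ((⊥ : Proj T) : T) ≤ t
        rw [(coe_bot_isZero s).2]
        exact coe_bot_le t
      directed' := fun e he f hf => ⟨e ⊔ f, (isLUB_mul_proj s e f).2 (by
        rintro x (rfl | rfl)
        · exact he
        · exact hf), le_sup_left, le_sup_right⟩ }
  by_contra hst
  have hs : pr s ∉ I := by
    intro h'
    have h'' : s * dom s ≤ t := h'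
    rw [mul_dom] at h''
    exact hst h''
  obtain ⟨χ, hχ, hχs, hχI⟩ := exists_primeChar hs
  obtain ⟨u, hus, hut, hu⟩ := h χ hχ hχs
  -- Since `u ≤ s`, the restriction `s u*` is `u` itself, which lies below `t`.
  have huI : pr u ∈ I := by
    change s * dom u ≤ t
    rwa [← le_def.1 hus]
  have hu' : χ.1 (pr u) = true := hu
  rw [hχI _ huI] at hu'
  exact Bool.false_ne_true hu'

end SameGerm
/-! ## Elements realizing sets of germs along a morphism -/

section Realizes

variable {S T : Type*} [RestrictionSemigroup S] [RestrictionSemigroup T]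

theorem RestrictionHom.onProj_pr (α : RestrictionHom S T) (s : S) :
    α.onProj (pr s) = pr (α.toFun s) := Subtype.ext (α.map_dom s)

theorem RestrictionHom.onProj_inf (α : RestrictionHom S T) (e f : Proj S) :
    α.onProj (e ⊓ f) = α.onProj e ⊓ α.onProj f := Subtype.ext (α.map_mul _ _)

theorem RestrictionHom.map_le (α : RestrictionHom S T) {s t : S} (h : s ≤ t) :
    α.toFun s ≤ α.toFun t := by
  rw [le_def, ← α.map_dom, ← α.map_mul, ← le_def.1 h]

/-- The character `φ` is the restriction of `χ` along `α`. -/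
def RestrictionHom.Restricts (α : RestrictionHom S T) (χ : Spectrum (Proj T))
    (φ : Spectrum (Proj S)) : Prop :=
  ∀ e, φ.1 e = χ.1 (α.onProj e)

variable {α : RestrictionHom S T} {χ : Spectrum (Proj T)} {φ ψ : Spectrum (Proj S)}

theorem RestrictionHom.Restricts.mem_Dom (h : α.Restricts χ φ) {s : S} :
    φ ∈ Dom s ↔ χ ∈ Dom (α.toFun s) := by
  change φ.1 (pr s) = true ↔ χ.1 (pr (α.toFun s)) = true
  rw [h, α.onProj_pr]

theorem RestrictionHom.Restricts.unique (h : α.Restricts χ φ) (k : α.Restricts χ ψ) : φ = ψ :=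
  Subtype.ext (funext fun e => (h e).trans (k e).symm)

/-- The only obstruction to pulling back a character is that the composite may be zero, which the
value at `e` rules out. -/
theorem RestrictionHom.exists_restricts (α : RestrictionHom S T) {e : Proj S}
    (h : χ.1 (α.onProj e) = true) : ∃ φ, α.Restricts χ φ :=
  ⟨⟨fun e => χ.1 (α.onProj e), ⟨e, h⟩, fun a b => by
    change χ.1 (α.onProj (a ⊓ b)) = (χ.1 (α.onProj a) && χ.1 (α.onProj b))
    rw [α.onProj_inf, χ.2.2]⟩, fun _ => rfl⟩

theorem RestrictionHom.Restricts.sameGerm (h : α.Restricts χ φ) {s t : S}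
    (k : SameGerm φ s t) : SameGerm χ (α.toFun s) (α.toFun t) := by
  obtain ⟨u, hs, ht, hu⟩ := k
  exact ⟨_, α.map_le hs, α.map_le ht, h.mem_Dom.1 hu⟩

theorem RestrictionHom.Restricts.act [HasLocalUnits S] [HasLocalUnits T]
    (h : α.Restricts χ φ) {s : S} (hs : φ ∈ Dom s) :
    α.Restricts (act (α.toFun s) χ (h.mem_Dom.1 hs)) (act s φ hs) := by
  intro e
  change φ.1 (pr ((e : S) * s)) = χ.1 (pr (α.toFun (e : S) * α.toFun s))
  rw [h, α.onProj_pr, α.map_mul]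

variable [BooleanRestrictionSemigroup T]

/-- The element `t` realizes the set of germs `U` along `α`: at each prime character `χ`, the germs
of `t` are those of the elements `α s` with `[s, χ ∘ α]` in `U`. -/
structure RestrictionHom.Realizes (α : RestrictionHom S T) (U : Set (Germ S)) (t : T) : Prop where
  sameGerm : ∀ {χ : Spectrum (Proj T)} {φ : Spectrum (Proj S)} {s : S} (h : φ ∈ Dom s),
    IsPrimeChar χ → α.Restricts χ φ → germ s φ h ∈ U → SameGerm χ (α.toFun s) t
  exists_germ : ∀ {χ : Spectrum (Proj T)}, IsPrimeChar χ → χ ∈ Dom t →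
    ∃ (s : S) (φ : Spectrum (Proj S)) (h : φ ∈ Dom s), α.Restricts χ φ ∧ germ s φ h ∈ U

namespace RestrictionHom.Realizes

variable {U V : Set (Germ S)} {s t : T}

theorem le (hs : α.Realizes U s) (ht : α.Realizes V t) (h : U ⊆ V) : s ≤ t := by
  refine le_of_sameGerm fun χ hχ hχs => ?_
  obtain ⟨a, φ, ha, hφ, haU⟩ := hs.exists_germ hχ hχs
  exact (hs.sameGerm ha hχ hφ haU).symm.trans (ht.sameGerm ha hχ hφ (h haU))

theorem unique (hs : α.Realizes U s) (ht : α.Realizes U t) : s = t :=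
  le_antisymm (hs.le ht subset_rfl) (ht.le hs subset_rfl)

theorem empty (α : RestrictionHom S T) : α.Realizes ∅ ((⊥ : Proj T) : T) where
  sameGerm _ _ _ h := h.elim
  exists_germ {χ} hχ h := by
    have h' : χ.1 (pr ((⊥ : Proj T) : T)) = true := h
    rw [pr_coe, hχ.map_bot] at h'
    exact (Bool.false_ne_true h').elim

/-- Primality enters here: a prime character in the domain of the join lies in the domain of `s` or
of `t`. -/
theorem sup {j : T} (hs : α.Realizes U s) (ht : α.Realizes V t) (hj : IsLUB {s, t} j) :
    α.Realizes (U ∪ V) j where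
  sameGerm := by
    rintro χ φ a h hχ hφ (haU | haV)
    · have := hs.sameGerm h hχ hφ haU
      exact this.trans (.of_le (hj.1 (Set.mem_insert _ _)) this.right)
    · have := ht.sameGerm h hχ hφ haV
      exact this.trans (.of_le (hj.1 (Set.mem_insert_of_mem _ rfl)) this.right)
  exists_germ {χ} hχ h := by
    have h' : χ.1 (pr j) = true := h
    rw [pr_eq_sup_of_isLUB hj, hχ.map_sup, Bool.or_eq_true] at h'
    obtain h' | h' := h'
    · obtain ⟨a, φ, ha, hφ, haU⟩ := hs.exists_germ hχ h'
      exact ⟨a, φ, ha, hφ, Or.inl haU⟩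
    · obtain ⟨a, φ, ha, hφ, haV⟩ := ht.exists_germ hχ h'
      exact ⟨a, φ, ha, hφ, Or.inr haV⟩

theorem basicSlice {a : S} {K : Set (Spectrum (Proj S))} (hK : K ⊆ Dom a) {q : Proj T}
    (hq : ∀ χ, IsPrimeChar χ → (χ.1 q = true ↔ ∃ φ, α.Restricts χ φ ∧ φ ∈ K)) :
    α.Realizes (basicSlice a K) (α.toFun a * (q : T)) := by
  have hle : α.toFun a * (q : T) ≤ α.toFun a := by
    rw [← proj_dom q]
    exact mul_dom_le _ _
  have hpr : pr (α.toFun a * (q : T)) = pr (α.toFun a) ⊓ q := by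
    rw [← proj_dom q, pr_mul_dom, pr_coe]
  constructor
  · rintro χ φ s h hχ hφ ⟨φ', h', hφ', e⟩
    obtain ⟨rfl, u⟩ := germ_eq_iff.1 e
    refine (hφ.sameGerm u).trans (SameGerm.of_le hle ?_).symm
    change χ.1 (pr _) = true
    rw [hpr, χ.2.2, Bool.and_eq_true]
    exact ⟨hφ.mem_Dom.1 h', (hq χ hχ).2 ⟨φ, hφ, hφ'⟩⟩
  · intro χ hχ h
    have h' : χ.1 (pr _) = true := h
    rw [hpr, χ.2.2, Bool.and_eq_true] at h'
    obtain ⟨φ, hφ, hφK⟩ := (hq χ hχ).1 h'.2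
    exact ⟨a, φ, hK hφK, hφ, φ, hK hφK, hφK, rfl⟩

end RestrictionHom.Realizes

/-! ### Cylinder neighbourhoods and the projections that encode them. -/

/-- A prescribed value `1` at `f` is imposed by a meet, a value `0` by a relative complement. The
projection `e` is the starting point, since `P(T)` need not have a top element. -/
theorem RestrictionHom.exists_proj_forall_iff (α : RestrictionHom S T) (φ : Spectrum (Proj S))
    (e : Proj S) (F : Finset (Proj S)) :
    ∃ q : Proj T, ∀ χ, IsPrimeChar χ → (χ.1 q = true ↔
      χ.1 (α.onProj e) = true ∧ ∀ f ∈ F, χ.1 (α.onProj f) = φ.1 f) := by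
  classical
  induction F using Finset.induction_on with
  | empty => exact ⟨α.onProj e, fun χ _ => by simp⟩
  | insert f F _ ih =>
    obtain ⟨q, hq⟩ := ih
    cases hf : φ.1 f with
    | true =>
      refine ⟨q ⊓ α.onProj f, fun χ hχ => ?_⟩
      rw [χ.2.2, Bool.and_eq_true, hq χ hχ, Finset.forall_mem_insert, hf]
      tauto
    | false =>
      refine ⟨q \ α.onProj f, fun χ hχ => ?_⟩
      rw [hχ.map_sdiff, Bool.and_eq_true, hq χ hχ, Finset.forall_mem_insert, hf, Bool.not_eq_true']
      tauto

/-- Every neighbourhood of a character contains an open neighbourhood that corresponds to a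
projection of `T`. -/
theorem RestrictionHom.exists_nhd (α : RestrictionHom S T) {O : Set (Spectrum (Proj S))}
    (hO : IsOpen O) (h : φ ∈ O) :
    ∃ K ⊆ O, IsOpen K ∧ φ ∈ K ∧ ∃ q : Proj T, ∀ χ, IsPrimeChar χ →
      (χ.1 q = true ↔ ∃ ψ, α.Restricts χ ψ ∧ ψ ∈ K) := by
  obtain ⟨O', hO', rfl⟩ := isOpen_induced_iff.1 hO
  obtain ⟨F, u, hu, hFu⟩ := isOpen_pi_iff.1 hO' φ.1 h
  obtain ⟨e, he⟩ := φ.2.1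
  obtain ⟨q, hq⟩ := α.exists_proj_forall_iff φ e F
  -- The condition at `e` also ensures that every prime character on which `q` is `1` has a non-zero
  -- pullback.
  refine ⟨{ψ | ψ.1 e = true ∧ ∀ f ∈ F, ψ.1 f = φ.1 f}, ?_, ?_, ⟨he, fun _ _ => rfl⟩, q, ?_⟩
  · rintro ψ ⟨-, hψ⟩
    refine hFu fun f hf => ?_
    rw [hψ f hf]
    exact (hu f hf).2
  · have : {ψ : Spectrum (Proj S) | ψ.1 e = true ∧ ∀ f ∈ F, ψ.1 f = φ.1 f} =
        Dset e ∩ ⋂ f ∈ F, (fun ψ : Spectrum (Proj S) => ψ.1 f) ⁻¹' {φ.1 f} := by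
      ext ψ
      simp [Dset]
    rw [this]
    exact (isOpen_Dset e).inter (isOpen_biInter_finset fun f _ =>
      (isOpen_discrete _).preimage (continuous_eval f))
  · intro χ hχ
    rw [hq χ hχ]
    constructor
    · rintro ⟨h1, h2⟩
      obtain ⟨ψ, hψ⟩ := α.exists_restricts h1
      exact ⟨ψ, hψ, (hψ e).trans h1, fun f hf => (hψ f).trans (h2 f hf)⟩
    · rintro ⟨ψ, hψ, h1, h2⟩
      exact ⟨(hψ e).symm.trans h1, fun f hf => (hψ f).symm.trans (h2 f hf)⟩

/-! ### Realization of domains and products, and compatibility. -/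

variable [HasLocalUnits S]

namespace RestrictionHom.Realizes

variable {U V W : Set (Germ S)} {s t : T}

theorem src_image (ht : α.Realizes U t) : α.Realizes (src '' U) (dom t) where
  sameGerm := by
    rintro χ φ s h hχ hφ ⟨x, hx, e⟩
    obtain ⟨b, ψ, hb, rfl⟩ := exists_rep' x
    obtain ⟨rfl, u⟩ := germ_eq_iff.1 (show germ (dom b) ψ (mem_Dom_dom hb) = germ s φ h from e)
    refine (hφ.sameGerm u).symm.trans ?_
    rw [α.map_dom]
    exact (ht.sameGerm hb hχ hφ hx).dom
  exists_germ {χ} hχ h := by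
    have h' : χ ∈ Dom t := by
      change χ.1 (pr t) = true
      rw [← pr_dom]
      exact h
    obtain ⟨s, φ, hs, hφ, hsU⟩ := ht.exists_germ hχ h'
    exact ⟨dom s, φ, mem_Dom_dom hs, hφ, _, hsU, rfl⟩

/-- The germ of `s t` at `χ` is the germ of `s` at `β_t(χ)` times that of `t` at `χ`, and pulling
back along `α` commutes with the spectral actions. -/
theorem mul [HasLocalUnits T] (hs : α.Realizes U s) (ht : α.Realizes V t) :
    α.Realizes (setMul U V) (s * t) where
  sameGerm := by
    rintro χ φ c h hχ hφ ⟨x, hx, y, hy, hxy, e⟩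
    obtain ⟨a, φ', ha, rfl⟩ := exists_rep' x
    obtain ⟨b, ψ, hb, rfl⟩ := exists_rep' y
    obtain rfl : φ' = act b ψ hb := gsrc_eq_gtgt_iff.1 hxy
    obtain ⟨rfl, u⟩ := germ_eq_iff.1 ((gcomp_germ a b ψ hb ha hxy).symm.trans e)
    refine (hφ.sameGerm u).symm.trans ?_
    rw [α.map_mul]
    exact (ht.sameGerm hb hχ hφ hy).mul (hs.sameGerm ha (hχ.act _ _) (hφ.act hb) hx)
  exists_germ {χ} hχ h := by
    have hχt := Dom_mul_subset s t h
    obtain ⟨b, φ, hb, hφ, hbV⟩ := ht.exists_germ hχ hχt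
    -- Having the same germ at `χ`, the elements `α b` and `t` move `χ` to the same point; this
    -- identifies the base point `ψ` obtained from `s` with `β_b(φ)`, so that the two germs compose.
    have hact := (ht.sameGerm hb hχ hφ hbV).act_eq
    obtain ⟨a, ψ, ha, hψ, haU⟩ := hs.exists_germ (hχ.act t hχt) ((mem_Dom_mul hχt).1 h)
    rw [← hact] at hψ
    obtain rfl := hψ.unique (hφ.act hb)
    exact ⟨a * b, φ, (mem_Dom_mul hb).2 ha, hφ, _, haU, _, hbV, gsrc_eq_gtgt_iff.2 rfl,
      gcomp_germ a b φ hb ha _⟩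

/-- Where both `s` and `t` are defined, their germs come from arrows of `W` with the same base
point, and injectivity of the domain map on `W` makes these arrows equal. -/
theorem mul_dom_le (hs : α.Realizes U s) (ht : α.Realizes V t) (hW : Set.InjOn src W)
    (hU : U ⊆ W) (hV : V ⊆ W) : s * dom t ≤ t := by
  refine le_of_sameGerm fun χ hχ hχs => ?_
  have h := hχs
  rw [Dom_mul_dom] at h
  obtain ⟨a, φ, ha, hφ, haU⟩ := hs.exists_germ hχ h.1
  obtain ⟨b, ψ, hb, hψ, hbV⟩ := ht.exists_germ hχ h.2
  obtain rfl := hφ.unique hψ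
  have hab : germ a φ ha = germ b φ hb := hW (hU haU) (hV hbV) (by
    change gsrc _ = gsrc _
    rw [gsrc_eq, gsrc_eq, pt_germ, pt_germ])
  have h1 := hs.sameGerm ha hχ hφ haU
  have h2 := ht.sameGerm hb hχ hφ hbV
  exact (SameGerm.of_le (UnivBool.mul_dom_le s t) hχs).trans
    (h1.symm.trans ((hφ.sameGerm ((sameGerm_iff ha hb).2 hab)).trans h2))

theorem compatible (hs : α.Realizes U s) (ht : α.Realizes V t) (hW : Set.InjOn src W)
    (hU : U ⊆ W) (hV : V ⊆ W) : Compatible s t := by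
  -- An element below `b` is the restriction of `b` to its own domain, here `a* b*`.
  have key : ∀ {a b : T}, a * dom b ≤ b → a * dom b ≤ b * dom a := fun {a b} h => by
    have h' := le_def.1 h
    rw [dom_mul_proj, ← mul_assoc] at h'
    rw [h']
    exact UnivBool.mul_dom_le _ _
  exact le_antisymm (key (hs.mul_dom_le ht hW hU hV)) (key (ht.mul_dom_le hs hW hV hU))

end RestrictionHom.Realizes

/-! ### Existence of realizing elements and the extension of `α`. -/

theorem RestrictionHom.exists_realizes (α : RestrictionHom S T) (U : Booleanization S) :
    ∃ t : T, α.Realizes U.1 t := by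
  -- Compact induction needs a property inherited by subsets, so a set is only required to be
  -- covered by a realized part `V` of `U`. Keeping `V` inside `U` makes the pieces compatible and
  -- forces `V = U` at the end.
  suffices h : ∃ V ⊆ U.1, U.1 ⊆ V ∧ ∃ t : T, α.Realizes V t by
    obtain ⟨V, h1, h2, h3⟩ := h
    rwa [subset_antisymm h2 h1]
  refine U.2.2.induction_on
    (p := fun A => ∃ V ⊆ U.1, A ⊆ V ∧ ∃ t : T, α.Realizes V t) ?_ ?_ ?_ ?_
  · exact ⟨∅, Set.empty_subset _, subset_rfl, _, .empty α⟩
  · rintro A B hAB ⟨V, h1, h2, h3⟩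
    exact ⟨V, h1, hAB.trans h2, h3⟩
  · rintro A B ⟨V, hV, hAV, s, hs⟩ ⟨W, hW, hBW, t, ht⟩
    obtain ⟨j, hj⟩ := BooleanRestrictionSemigroup.exists_join s t
      (hs.compatible ht U.2.1.injOn hV hW)
    exact ⟨V ∪ W, Set.union_subset hV hW, Set.union_subset_union hAV hBW, j, hs.sup ht hj⟩
  · intro x hx
    obtain ⟨s, φ, hs, rfl⟩ := exists_rep' x
    obtain ⟨K, hKO, hK, hφ, q, hq⟩ := α.exists_nhd (isOpen_trace s U.2.1.isOpen)
      (⟨hs, hx⟩ : φ ∈ trace s U.1)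
    have hKs : K ⊆ Dom s := hKO.trans (trace_subset s _)
    refine ⟨basicSlice s K,
      mem_nhdsWithin_of_mem_nhds ((isOpen_basicSlice s hK hKs).mem_nhds ⟨φ, hs, hφ, rfl⟩),
      basicSlice s K, ?_, subset_rfl, _, .basicSlice hKs hq⟩
    rintro _ ⟨ψ, k, hψ, rfl⟩
    exact (hKO hψ).2

/-- The element of `T` that realizes a compact slice along `α`. -/
noncomputable def RestrictionHom.realization (α : RestrictionHom S T) (U : Booleanization S) : T :=
  (α.exists_realizes U).choose

theorem RestrictionHom.realizes_realization (α : RestrictionHom S T) (U : Booleanization S) :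
    α.Realizes U.1 (α.realization U) :=
  (α.exists_realizes U).choose_spec

/-- The slice `ι s` is the basic slice over all of `D_{s*}`, which is encoded by the projection `(α
s)*`; and `α(s) (α s)* = α s`. -/
theorem RestrictionHom.realization_toBooleanization (α : RestrictionHom S T) (s : S) :
    α.realization ((toBooleanization S).toFun s) = α.toFun s := by
  have h : α.Realizes (basicSlice s (Dom s)) (α.toFun s * ((pr (α.toFun s) : Proj T) : T)) := by
    refine .basicSlice subset_rfl fun χ _ => ⟨fun h => ?_, fun ⟨φ, hφ, h⟩ => hφ.mem_Dom.1 h⟩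
    rw [← α.onProj_pr] at h
    obtain ⟨φ, hφ⟩ := α.exists_restricts h
    exact ⟨φ, hφ, (hφ _).trans h⟩
  refine ((α.realizes_realization _).unique h).trans ?_
  exact mul_dom _

/-- The extension to `B(S)` of a `(·, *)`-morphism from `S` to a Boolean restriction semigroup. -/
noncomputable def RestrictionHom.extend [HasLocalUnits T] (α : RestrictionHom S T) :
    RestrictionHom (Booleanization S) T where
  toFun := α.realization
  map_mul U V := (α.realizes_realization _).unique
    ((α.realizes_realization U).mul (α.realizes_realization V))
  map_dom U := (α.realizes_realization _).unique (α.realizes_realization U).src_image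

/-- Here the join is taken among projections only, but the union is itself a compact open set of
units and so competes as an upper bound. -/
theorem coe_eq_union_of_isLUB_proj {C : Type*} [ArrowCat C] [TopologicalSpace C] [IsEtale C]
    {x y j : Proj (CompactSlice C)} (h : IsLUB {x, y} j) : j.1.1 = x.1.1 ∪ y.1.1 := by
  have hx : x.1.1 ⊆ j.1.1 := slice_le_iff.1 (h.1 (Set.mem_insert _ _))
  have hy : y.1.1 ⊆ j.1.1 := slice_le_iff.1 (h.1 (Set.mem_insert_of_mem _ rfl))
  refine subset_antisymm ?_ (Set.union_subset hx hy)
  let k : Proj (CompactSlice C) := mkProj (x.1.1 ∪ y.1.1)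
    (x.1.2.1.isOpen.union y.1.2.1.isOpen) (x.1.2.2.union y.1.2.2)
    (Set.union_subset (proj_subset_units x) (proj_subset_units y))
  have hk : j ≤ k := by
    refine h.2 ?_
    rintro z (rfl | rfl)
    · exact slice_le_iff.2 Set.subset_union_left
    · exact slice_le_iff.2 Set.subset_union_right
  exact slice_le_iff.1 hk

theorem coe_eq_empty_of_isBot_proj {C : Type*} [ArrowCat C] [TopologicalSpace C] [IsEtale C]
    {z : Proj (CompactSlice C)} (h : IsBot z) : z.1.1 = ∅ :=
  Set.subset_empty_iff.1
    (slice_le_iff.1 (h (mkProj ∅ isOpen_empty isCompact_empty (Set.empty_subset _))))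

theorem RestrictionHom.extend_onProj_morphism [HasLocalUnits T] (α : RestrictionHom S T)
    (hα : IsNonDegenerate α.onProj) : IsGenBoolMorphism α.extend.onProj where
  map_bot z hz := by
    have h := α.realizes_realization z.1
    rw [coe_eq_empty_of_isBot_proj hz] at h
    have : α.extend.onProj z = ⊥ := Subtype.ext (h.unique (.empty α))
    rw [this]
    exact isBot_bot
  map_inf x y m h := by
    obtain rfl := h.unique isGLB_pair
    rw [α.extend.onProj_inf]
    exact isGLB_pair
  map_sup x y j h := by
    have hj := α.realizes_realization j.1
    rw [coe_eq_union_of_isLUB_proj h] at hj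
    have : α.extend.onProj j = α.extend.onProj x ⊔ α.extend.onProj y :=
      Subtype.ext (hj.unique ((α.realizes_realization x.1).sup (α.realizes_realization y.1)
        (isLUB_coe_proj (α.extend.onProj x) (α.extend.onProj y))))
    rw [this]
    exact isLUB_pair
  -- As `ψ ∘ ι = α`, the image of `ψ` on projections contains that of `α`, so an ideal containing
  -- the former contains the latter.
  nonDegenerate I hI := by
    refine hα I ?_
    rintro _ ⟨e, rfl⟩
    refine hI ⟨(toBooleanization S).onProj e, Subtype.ext ?_⟩
    exact α.realization_toBooleanization e

end Realizes

end UnivBool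

theorem mainTheorem2 {S T : Type*}
    [UnivBool.RestrictionSemigroup S] [UnivBool.HasLocalUnits S]
    [UnivBool.RestrictionSemigroup T] [UnivBool.BooleanRestrictionSemigroup T]
    [UnivBool.HasLocalUnits T]
    (α : UnivBool.RestrictionHom S T) (hα : UnivBool.IsNonDegenerate α.onProj) :
    ∃ ψ : UnivBool.BooleanRestrictionHom (UnivBool.Booleanization S) T,
      α.toFun = ψ.toFun ∘ (UnivBool.toBooleanization S).toFun :=
  ⟨{ α.extend with onProj_morphism := α.extend_onProj_morphism hα },
    funext fun s => (α.realization_toBooleanization s).symm⟩
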